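/- **Proposition 3.4.** Let $n\ge 2$. Let $\Omega\subset\mathbb R^n$ be open, non-empty and bounded, let $\Omega'\subset\Omega$ be compact and non-empty, and let $W\subset\Omega_e:=\mathbb R^n\setminus\overline\Omega$ be open and non-empty (in particular these sets may be Lipschitz sets, but no boundary regularity is needed). For $s\in(0,1)$ let $H^s(\mathbb R^n)$ be the space of (complex-valued) $u\in L^2(\mathbb R^n)$ with $\|u\|_{H^s(\mathbb R^n)}:=\|(1+|\xi|^2)^{s/2}\hat u\|_{L^2(\mathbb R^n)}<\infty$, where $\hat u$ is the Fourier transform in the frequency variable $\xi$ dual to $-i\nabla$, normalized to be unitary on $L^2$. Let $\widetilde H^s(W)$ be the closure of $C_c^\infty(W)$ in $H^s(\mathbb R^n)$, with the norm $\|f\|_{\widetilde H^s(W)}:=\|f\|_{H^s(\mathbb R^n)}$. For $f\in\widetilde H^s(W)$, a solution of $$(-\Delta)^s u_0=0\ \text{ in }\Omega,\qquad u_0=f\ \text{ in }\Omega_e,$$ is a function $u_0\in H^s(\mathbb R^n)$ with $u_0=f$ a.e. in $\Omega_e$ and $$\int_{\mathbb R^n}|\xi|^{2s}\,\hat u_0(\xi)\,\overline{\hat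 v(\xi)}\,d\xi=0\qquad\text{for all } v\in H^s(\mathbb R^n)\text{ with } v=0 \text{ a.e. in }\Omega_e .$$ There exist constants $C,R>0$, depending only on $\Omega',\Omega,W,n$, such that for all $s\in(0,1)$ and all $f\in\widetilde H^s(W)$ this problem has exactly one solution $u_0$, this $u_0$ agrees a.e. in $\Omega$ with a function that is real-analytic in $\Omega$ (and is again denoted by $u_0$), one has $u_0|_{\Omega'}\in G^1(\Omega')$, and $$\|D^\tau u_0\|_{L^\infty(\Omega')}\le C\,\|f\|_{\widetilde H^s(W)}\,R^{|\tau|}\,|\tau|^{|\tau|}\qquad\text{for all }\tau\in\mathbb N_0^n,$$ with the convention $0^0=1$. Here $G^1(\Omega')$ is the Gevrey class of functions $g$ that are smooth in a neighbourhood of $\Omega'$ and for which there are $C_g,R_g>0$ with $\|D^\tau g\|_{L^\infty(\Omega')}\le C_g R_g^{|\tau|}|\tau|^{|\tau|}$ for all $\tau\in\mathbb N_0^n$. -/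

import Mathlib

open MeasureTheory Set
open scoped FourierTransform SchwartzMap ENNReal ContDiff

noncomputable section

namespace FracCalderon

/-- `ℝⁿ` with the Euclidean norm. -/
abbrev Rn (n : ℕ) : Type := EuclideanSpace ℝ (Fin n)

/-- `L²(ℝⁿ; ℂ)`. -/
abbrev L2 (n : ℕ) : Type := Lp ℂ 2 (volume : Measure (Rn n))

/-- The norm `‖u‖_{H^s(ℝⁿ)} = ‖(1 + |2πξ|²)^{s/2} û‖_{L²}`, with value `∞` if `u ∉ H^s(ℝⁿ)`.
It is only used for `s ≥ 0`, where `H^s(ℝⁿ) ⊆ L²(ℝⁿ)`. Mathlib's Fourier transform is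
`û(ξ) = ∫ exp(-2πi x·ξ) u(x) dx`, so that the frequency variable dual to `-i∇` is `2πξ`. -/
def hsNorm {n : ℕ} (s : ℝ) (u : L2 n) : ℝ≥0∞ :=
  eLpNorm (fun ξ : Rn n ↦
    (((1 + (2 * Real.pi * ‖ξ‖) ^ 2) ^ (s / 2) : ℝ) : ℂ) * (𝓕 u : L2 n) ξ) 2 volume

/-- `u ∈ H^s(ℝⁿ)`. -/
def MemHs {n : ℕ} (s : ℝ) (u : L2 n) : Prop := hsNorm s u < ⊤

/-- `f ∈ H̃^s(W)`, the closure of `C_c^∞(W)` in `H^s(ℝⁿ)`; its norm is that of `H^s(ℝⁿ)`. -/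
def MemHsTilde {n : ℕ} (s : ℝ) (W : Set (Rn n)) (f : L2 n) : Prop :=
  MemHs s f ∧ ∀ ε : ℝ≥0∞, 0 < ε → ∃ φ : 𝓢(Rn n, ℂ),
    HasCompactSupport φ ∧ tsupport φ ⊆ W ∧ hsNorm s (f - φ.toLp 2 (volume : Measure (Rn n))) < ε

/-- The exterior `Ω_e = ℝⁿ \ closure Ω`. -/
def exteriorSet {n : ℕ} (Ω : Set (Rn n)) : Set (Rn n) := (closure Ω)ᶜ

/-- The duality pairing `⟨(-Δ)^s u, v⟩` of `(-Δ)^s u = 𝓕⁻¹(|2πξ|^{2s} û) ∈ H^{-s}(ℝⁿ)` with the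
complex conjugate of `v ∈ H^s(ℝⁿ)`, written on the Fourier side. -/
def fracLaplacePairing {n : ℕ} (s : ℝ) (u v : L2 n) : ℂ :=
  ∫ ξ : Rn n, (((2 * Real.pi * ‖ξ‖) ^ (2 * s) : ℝ) : ℂ) *
    ((𝓕 u : L2 n) ξ * starRingEnd ℂ ((𝓕 v : L2 n) ξ))

/-- `u ∈ H^s(ℝⁿ)` is a weak solution of `(-Δ)^s u = 0` in `Ω`, `u = f` in `Ω_e`: the test
functions are all `v ∈ H^s(ℝⁿ)` that vanish almost everywhere in `Ω_e`. -/
structure IsWeakSolution {n : ℕ} (s : ℝ) (Ω : Set (Rn n)) (f u : L2 n) : Prop where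
  memHs : MemHs s u
  exterior : ∀ᵐ x ∂(volume.restrict (exteriorSet Ω)), u x = f x
  equation : ∀ v : L2 n, MemHs s v → (∀ᵐ x ∂(volume.restrict (exteriorSet Ω)), v x = 0) →
    fracLaplacePairing s u v = 0

/-- The partial derivative `∂_i g`. -/
def pderiv {n : ℕ} (i : Fin n) (g : Rn n → ℂ) : Rn n → ℂ :=
  fun x ↦ fderiv ℝ g x (EuclideanSpace.single i 1)

/-- `D^τ g = ∂_0^{τ_0} ⋯ ∂_{n-1}^{τ_{n-1}} g` for a multi-index `τ`. -/
def mderiv {n : ℕ} (τ : Fin n → ℕ) (g : Rn n → ℂ) : Rn n → ℂ :=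
  (List.finRange n).foldr (fun i h ↦ (pderiv i)^[τ i] h) g

/-- The length `|τ|` of a multi-index. -/
def mlen {n : ℕ} (τ : Fin n → ℕ) : ℕ := ∑ i, τ i

/-- `g ∈ G^σ(K)` for a compact `K`: `g` is smooth in a neighbourhood of `K`, and
`‖D^τ g‖_{L^∞(K)} ≤ C R^{|τ|} |τ|^{σ|τ|}` for all multi-indices `τ`. -/
def MemGevrey {n : ℕ} (σ : ℝ) (K : Set (Rn n)) (g : Rn n → ℂ) : Prop :=
  (∃ U : Set (Rn n), IsOpen U ∧ K ⊆ U ∧ ContDiffOn ℝ ∞ g U) ∧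
    ∃ C R : ℝ, 0 < C ∧ 0 < R ∧ ∀ τ : Fin n → ℕ, ∀ x ∈ K,
      ‖mderiv τ g x‖ ≤ C * R ^ mlen τ * (mlen τ : ℝ) ^ (σ * (mlen τ : ℝ))

end FracCalderon

end

noncomputable section

namespace FracCalderon

variable {n : ℕ}

/-! The difficulty is uniformity in `s`; existence and analyticity for a fixed order are classical.

Well-posedness rests on a Poincaré inequality `‖v‖ ≤ c ‖|2πξ|^s v̂‖` for `v` vanishing outside the
closure of a bounded set, with `c` independent of `s` (`exists_poincare`). Such a `v` is in `L¹`, so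
`v̂` is bounded and the low frequencies carry at most half of `‖v‖²`; on the high frequencies the
weight is bounded below uniformly in `s`. The image of the test space under `v ↦ |2πξ|^s v̂` is then
closed in `L²`, and orthogonal projection onto it yields the solution and the bound of `‖u‖` by the
data (`exists_wellposed`).

For interior regularity, suppose `(-Δ)^s u = 0` in a ball about the origin. Pair `(-Δ)^s u` with the
heat kernel at time `t` whose pole `κh` is complex and small. The part of the kernel cut off near
the origin is an admissible test function and contributes nothing; the rest lives away from the
pole, where the kernel and its derivatives are bounded uniformly as `t → 0`. Hence the heat flow of
`(-Δ)^s u` is bounded in a complex neighbourhood of the origin, uniformly in small time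
(`exists_heat_bound`). Subordination, `Γ(s) = a^{2s} ∫₀^∞ t^{s-1} e^{-ta²} dt` with `a = 2π|ξ|`,
recovers `u` from this flow. Times `t ≤ 1` are controlled by the heat bound, times `t > 1` by a
Gaussian in frequency, and both pieces are `O(Γ(s))`, so that division by `Γ(s)` leaves a constant
free of `s` (`exists_mollified_bound`). To have convergent integrals throughout, this is done for
`e^{εΔ}u`, with bounds independent of `ε`.

Boundedness on complex lines gives Cauchy estimates for the diagonal Taylor coefficients of the
mollifications, and polarization turns them into geometric bounds for the full multilinear
coefficients (`norm_taylorSeries_le`). Compactness lets `ε → 0` (`exists_local_analytic`).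
Translation, gluing and the uniform distance from the compact set to the boundary finish the
argument; the factor `|τ|^{|τ|}` comes from `k! ≤ k^k`. -/

/-! ### The Fourier transform on `L¹ ∩ L²` -/

/-- A smooth compactly supported function as a Schwartz function. -/
lemma exists_schwartz_of_compactSupport {g : Rn n → ℝ} (hg : ContDiff ℝ ∞ g)
    (hs : HasCompactSupport g) : ∃ φ : 𝓢(Rn n, ℂ), ∀ x, φ x = (g x : ℂ) := by
  have h1 : HasCompactSupport (fun x ↦ (g x : ℂ)) := hs.comp_left (g := fun t : ℝ ↦ (t : ℂ)) (by simp)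
  have h2 : ContDiff ℝ ∞ (fun x ↦ (g x : ℂ)) := Complex.ofRealCLM.contDiff.comp hg
  exact ⟨h1.toSchwartzMap h2, fun x ↦ by simp⟩

lemma ae_eq_of_forall_schwartz {f g : Rn n → ℂ} (hf : LocallyIntegrable f)
    (hg : LocallyIntegrable g) (h : ∀ φ : 𝓢(Rn n, ℂ), ∫ x, φ x • f x = ∫ x, φ x • g x) :
    f =ᵐ[volume] g := by
  refine ae_eq_of_integral_contDiff_smul_eq hf hg fun φ hφ hs ↦ ?_
  obtain ⟨ψ, hψ⟩ := exists_schwartz_of_compactSupport hφ hs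
  simpa [hψ] using h ψ

/-- The Fourier transform on `L²` and the Fourier integral act identically on Schwartz functions:
the first through tempered distributions, the second through the multiplication formula for `L¹`
functions. -/
lemma lp_fourier_ae_eq (H : L2 n) (hH : Integrable H) :
    ((𝓕 H : L2 n) : Rn n → ℂ) =ᵐ[volume] 𝓕 (H : Rn n → ℂ) := by
  refine ae_eq_of_forall_schwartz ((Lp.memLp _).locallyIntegrable (by norm_num))
    (Continuous.locallyIntegrable ?_) fun φ ↦ ?_
  · exact VectorFourier.fourierIntegral_continuous Real.continuous_fourierChar
      (by exact continuous_inner) hH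
  · have h1 := congrArg (fun T ↦ T φ) (Lp.fourier_toTemperedDistribution_eq H)
    simp only [TemperedDistribution.fourier_apply, Lp.toTemperedDistribution_apply] at h1
    rw [← h1, SchwartzMap.fourier_coe]
    simpa using! (VectorFourier.integral_fourierIntegral_smul_eq_flip (L := innerₗ (Rn n))
      Real.continuous_fourierChar continuous_inner φ.integrable hH)

lemma lp_fourierInv_ae_eq (H : L2 n) (hH : Integrable H) :
    ((𝓕⁻ H : L2 n) : Rn n → ℂ) =ᵐ[volume] 𝓕⁻ (H : Rn n → ℂ) := by
  refine ae_eq_of_forall_schwartz ((Lp.memLp _).locallyIntegrable (by norm_num))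
    (Continuous.locallyIntegrable ?_) fun φ ↦ ?_
  · exact VectorFourier.fourierIntegral_continuous Real.continuous_fourierChar
      (L := -innerₗ (Rn n)) (by exact continuous_inner.neg) hH
  · have h1 := congrArg (fun T ↦ T φ) (Lp.fourierInv_toTemperedDistribution_eq H)
    simp only [TemperedDistribution.fourierInv_apply, Lp.toTemperedDistribution_apply] at h1
    rw [← h1, SchwartzMap.fourierInv_coe]
    have hf : (-innerₗ (Rn n)).flip = -innerₗ (Rn n) := by
      ext x y; simp [real_inner_comm]
    have := (VectorFourier.integral_fourierIntegral_smul_eq_flip (L := -innerₗ (Rn n))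
      Real.continuous_fourierChar (by exact continuous_inner.neg) (φ.integrable (μ := volume)) hH)
    rw [hf] at this
    exact this

/-! ### Weighted spaces on the Fourier side -/

lemma norm_sq_eq_integral (f : L2 n) : ‖f‖ ^ 2 = ∫ x, ‖f x‖ ^ 2 := by
  rw [← inner_self_eq_norm_sq (𝕜 := ℂ) f, L2.inner_def]
  rw [← integral_re (L2.integrable_inner f f)]
  refine integral_congr_ae (Filter.Eventually.of_forall fun x ↦ ?_)
  simp only [inner_self_eq_norm_sq]

lemma integrable_norm_sq (f : L2 n) : Integrable (fun x ↦ ‖f x‖ ^ 2) :=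
  (Lp.memLp f).integrable_norm_pow (by norm_num)

lemma measurable_freq_rpow (s : ℝ) : Measurable fun ξ : Rn n ↦ (2 * Real.pi * ‖ξ‖) ^ s := by
  fun_prop

lemma freq_rpow_le {s : ℝ} (hs : 0 ≤ s) (ξ : Rn n) :
    (2 * Real.pi * ‖ξ‖) ^ s ≤ (1 + (2 * Real.pi * ‖ξ‖) ^ 2) ^ (s / 2) := by
  have h0 : 0 ≤ 2 * Real.pi * ‖ξ‖ := by positivity
  calc (2 * Real.pi * ‖ξ‖) ^ s = ((2 * Real.pi * ‖ξ‖) ^ 2) ^ (s / 2) := by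
        rw [← Real.rpow_natCast, ← Real.rpow_mul h0]; congr 1; push_cast; ring
    _ ≤ _ := Real.rpow_le_rpow (by positivity) (by linarith) (by linarith)

lemma bessel_le {s : ℝ} (hs : 0 ≤ s) (hs1 : s ≤ 1) (ξ : Rn n) :
    (1 + (2 * Real.pi * ‖ξ‖) ^ 2) ^ (s / 2) ≤ 1 + (2 * Real.pi * ‖ξ‖) ^ s := by
  have h0 : 0 ≤ 2 * Real.pi * ‖ξ‖ := by positivity
  calc (1 + (2 * Real.pi * ‖ξ‖) ^ 2) ^ (s / 2)
      ≤ 1 ^ (s / 2) + ((2 * Real.pi * ‖ξ‖) ^ 2) ^ (s / 2) :=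
        Real.rpow_add_le_add_rpow (by positivity) (by positivity) (by linarith) (by linarith)
    _ = _ := by
        rw [Real.one_rpow, ← Real.rpow_natCast, ← Real.rpow_mul h0]; congr 2; push_cast; ring

/-- `|2πξ|^s û`. -/
def homFourier (s : ℝ) (u : L2 n) : Rn n → ℂ :=
  fun ξ ↦ (((2 * Real.pi * ‖ξ‖) ^ s : ℝ) : ℂ) * (𝓕 u : L2 n) ξ

lemma aestronglyMeasurable_homFourier (s : ℝ) (u : L2 n) :
    AEStronglyMeasurable (homFourier s u) volume := by
  refine AEStronglyMeasurable.mul ?_ (Lp.aestronglyMeasurable _)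
  exact (Complex.measurable_ofReal.comp (measurable_freq_rpow s)).aestronglyMeasurable

lemma eLpNorm_homFourier_le {s : ℝ} (hs : 0 ≤ s) (u : L2 n) :
    eLpNorm (homFourier s u) 2 volume ≤ hsNorm s u := by
  refine eLpNorm_mono fun ξ ↦ ?_
  have h0 : 0 ≤ 2 * Real.pi * ‖ξ‖ := by positivity
  simp only [homFourier, norm_mul, Complex.norm_real, Real.norm_eq_abs]
  rw [abs_of_nonneg (by positivity), abs_of_nonneg (by positivity)]
  gcongr
  exact freq_rpow_le hs ξ

lemma MemHs.memLp_homFourier {s : ℝ} (hs : 0 ≤ s) {u : L2 n} (hu : MemHs s u) :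
    MemLp (homFourier s u) 2 volume :=
  ⟨aestronglyMeasurable_homFourier s u, (eLpNorm_homFourier_le hs u).trans_lt hu⟩

/-- Since `u` is already in `L²`, the Bessel weight may be replaced by the homogeneous one, by
subadditivity of `x ↦ x^(s/2)`. -/
lemma memHs_of_memLp_homFourier {s : ℝ} (hs : 0 ≤ s) (hs1 : s ≤ 1) {u : L2 n}
    (hu : MemLp (homFourier s u) 2 volume) : MemHs s u := by
  have h2 : MemLp (fun ξ ↦ ‖(𝓕 u : L2 n) ξ‖ + ‖homFourier s u ξ‖) 2 volume :=
    (Lp.memLp (𝓕 u : L2 n)).norm.add hu.norm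
  refine lt_of_le_of_lt (eLpNorm_mono fun ξ ↦ ?_) h2.2
  have h0 : 0 ≤ 2 * Real.pi * ‖ξ‖ := by positivity
  simp only [homFourier, norm_mul, Complex.norm_real, Real.norm_eq_abs]
  rw [abs_of_nonneg (by positivity), abs_of_nonneg (by positivity), abs_of_nonneg (by positivity)]
  calc _ ≤ (1 + (2 * Real.pi * ‖ξ‖) ^ s) * ‖(𝓕 u : L2 n) ξ‖ := by
        gcongr; exact bessel_le hs hs1 ξ
    _ = _ := by ring

lemma norm_le_hsNorm {s : ℝ} (hs : 0 ≤ s) {u : L2 n} (hu : MemHs s u) :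
    ‖u‖ ≤ (hsNorm s u).toReal := by
  rw [← Lp.norm_fourier_eq u, Lp.norm_def]
  refine ENNReal.toReal_mono hu.ne (eLpNorm_mono fun ξ ↦ ?_)
  simp only [norm_mul, Complex.norm_real, Real.norm_eq_abs]
  rw [abs_of_nonneg (by positivity)]
  have : 1 ≤ (1 + (2 * Real.pi * ‖ξ‖) ^ 2) ^ (s / 2) :=
    Real.one_le_rpow (by nlinarith [sq_nonneg (2 * Real.pi * ‖ξ‖)]) (by linarith)
  nlinarith [norm_nonneg ((𝓕 u : L2 n) ξ)]

lemma homFourier_add (s : ℝ) (u v : L2 n) :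
    homFourier s (u + v) =ᵐ[volume] homFourier s u + homFourier s v := by
  have : (𝓕 (u + v) : L2 n) = 𝓕 u + 𝓕 v := FourierTransform.fourier_add u v
  filter_upwards [Lp.coeFn_add (𝓕 u : L2 n) (𝓕 v : L2 n)] with ξ h
  simp only [homFourier, this, h, Pi.add_apply]
  ring

lemma homFourier_smul (s : ℝ) (c : ℂ) (u : L2 n) :
    homFourier s (c • u) =ᵐ[volume] c • homFourier s u := by
  have : (𝓕 (c • u) : L2 n) = c • 𝓕 u := FourierTransform.fourier_smul c u
  filter_upwards [Lp.coeFn_smul c (𝓕 u : L2 n)] with ξ h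
  simp only [homFourier, this, h, Pi.smul_apply, smul_eq_mul]
  ring

lemma MemHs.add {s : ℝ} (hs : 0 ≤ s) (hs1 : s ≤ 1) {u v : L2 n} (hu : MemHs s u)
    (hv : MemHs s v) : MemHs s (u + v) :=
  memHs_of_memLp_homFourier hs hs1 (((hu.memLp_homFourier hs).add
    (hv.memLp_homFourier hs)).ae_eq (homFourier_add s u v).symm)

lemma MemHs.smul {s : ℝ} (hs : 0 ≤ s) (hs1 : s ≤ 1) {u : L2 n} (hu : MemHs s u) (c : ℂ) :
    MemHs s (c • u) :=
  memHs_of_memLp_homFourier hs hs1 (((hu.memLp_homFourier hs).const_smul c).ae_eq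
    (homFourier_smul s c u).symm)

open scoped ComplexInnerProductSpace in
-- Splitting `|2πξ|^{2s}` evenly makes the weak equation an orthogonality relation in `L²`; the test
-- function is in the conjugated slot.
lemma fracLaplacePairing_eq_inner {s : ℝ} {u v U V : L2 n}
    (hU : (U : Rn n → ℂ) =ᵐ[volume] homFourier s u)
    (hV : (V : Rn n → ℂ) =ᵐ[volume] homFourier s v) :
    fracLaplacePairing s u v = ⟪V, U⟫ := by
  rw [L2.inner_def, fracLaplacePairing]
  refine integral_congr_ae ?_
  filter_upwards [hU, hV] with ξ h1 h2
  have h0 : 0 ≤ 2 * Real.pi * ‖ξ‖ := by positivity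
  have h3 : (2 * Real.pi * ‖ξ‖) ^ (2 * s) = (2 * Real.pi * ‖ξ‖) ^ s * (2 * Real.pi * ‖ξ‖) ^ s := by
    rw [mul_comm 2 s, Real.rpow_mul h0]
    norm_num [sq]
  simp only [h1, h2, homFourier, h3, RCLike.inner_apply, map_mul, Complex.conj_ofReal,
    Complex.ofReal_mul]
  ring

/-! ### The Poincaré inequality and the solution of the exterior value problem -/

lemma integral_norm_le_of_support {K : Set (Rn n)} (hK : MeasurableSet K) (hKf : volume K ≠ ⊤)
    (v : L2 n) (hv : ∀ᵐ x ∂(volume.restrict Kᶜ), v x = 0) :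
    Integrable v ∧ ∫ x, ‖v x‖ ≤ ‖v‖ * (volume K ^ (1 / 2 : ℝ)).toReal := by
  have hv' : ∀ᵐ x, x ∉ K → v x = 0 := (ae_restrict_iff' hK.compl).1 hv
  have : IsFiniteMeasure (volume.restrict K) := ⟨by simpa using hKf.lt_top⟩
  have hmem : MemLp v 2 (volume.restrict K) := (Lp.memLp v).restrict K
  have hint : IntegrableOn v K := hmem.integrable (by norm_num)
  have hI : Integrable v := hint.integrable_of_ae_notMem_eq_zero hv'
  refine ⟨hI, ?_⟩
  have h1 : ∫ x, ‖v x‖ = ∫ x in K, ‖v x‖ := by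
    refine (setIntegral_eq_integral_of_ae_compl_eq_zero ?_).symm
    filter_upwards [hv'] with x hx hxK
    simp [hx hxK]
  rw [h1, integral_norm_eq_lintegral_enorm hint.aestronglyMeasurable, Lp.norm_def,
    ← ENNReal.toReal_mul]
  refine ENNReal.toReal_mono (ENNReal.mul_ne_top (Lp.eLpNorm_ne_top v)
    (ENNReal.rpow_ne_top_of_nonneg (by norm_num) hKf)) ?_
  rw [← eLpNorm_one_eq_lintegral_enorm]
  have h2 := eLpNorm_le_eLpNorm_mul_rpow_measure_univ (p := 1) (q := 2)
    (μ := volume.restrict K) (by norm_num) hmem.1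
  refine h2.trans ?_
  have h3 : 1 / ENNReal.toReal 1 - 1 / ENNReal.toReal 2 = 1 / 2 := by norm_num
  rw [Measure.restrict_apply_univ, h3]
  gcongr
  exact Measure.restrict_le_self

/-- For `|ξ| < r` the bound `|v̂| ≤ ‖v‖_{L¹} ≤ B‖v‖` is used, and for `|ξ| ≥ r` the weight is at
least `q^s ≥ q` with `q = 2πr`. The low-frequency term is absorbed in the left side. -/
lemma exists_poincare (hn : 1 ≤ n) {Ω : Set (Rn n)} (hΩb : Bornology.IsBounded Ω) :
    ∃ c : ℝ, 0 < c ∧ ∀ s : ℝ, 0 < s → s < 1 → ∀ v V : L2 n,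
      (V : Rn n → ℂ) =ᵐ[volume] homFourier s v →
      (∀ᵐ x ∂(volume.restrict (exteriorSet Ω)), v x = 0) → ‖v‖ ≤ c * ‖V‖ := by
  have hKf : volume (closure Ω) ≠ ⊤ := hΩb.closure.measure_lt_top.ne
  set B := (volume (closure Ω) ^ (1 / 2 : ℝ)).toReal with hB
  set β := (volume (Metric.ball (0 : Rn n) 1)).toReal with hβ
  have hB0 : 0 ≤ B := ENNReal.toReal_nonneg
  have hβ0 : 0 ≤ β := ENNReal.toReal_nonneg
  have hpi := Real.pi_gt_three
  -- The first bound gives `q = 2πr ≤ 1`, hence `q ≤ q^s` for every `s < 1`; the second makes the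
  -- low-frequency mass at most `‖v‖² / 2`.
  set r : ℝ := min (1 / (2 * Real.pi)) (1 / (2 * (B ^ 2 * β + 1))) with hr
  have hr0 : 0 < r := by positivity
  have hrpi : 2 * Real.pi * r ≤ 1 := by
    have : r ≤ 1 / (2 * Real.pi) := min_le_left _ _
    rw [le_div_iff₀ (by positivity)] at this
    linarith
  have hr1 : r ≤ 1 := by nlinarith
  have hrB : B ^ 2 * (r * β) ≤ 1 / 2 := by
    have : r ≤ 1 / (2 * (B ^ 2 * β + 1)) := min_le_right _ _
    rw [le_div_iff₀ (by positivity)] at this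
    nlinarith
  have hvol : (volume (Metric.ball (0 : Rn n) r)).toReal ≤ r * β := by
    have : Nonempty (Fin n) := ⟨⟨0, hn⟩⟩
    rw [Measure.addHaar_ball _ _ hr0.le, ENNReal.toReal_mul, ENNReal.toReal_ofReal (by positivity)]
    gcongr
    simpa using pow_le_pow_of_le_one hr0.le hr1 (show 1 ≤ Module.finrank ℝ (Rn n) by simpa using hn)
  set q := 2 * Real.pi * r with hq
  have hq0 : 0 < q := by positivity
  refine ⟨2 / q, by positivity, fun s hs0 hs1 v V hV hv ↦ ?_⟩
  obtain ⟨hvi, hvn⟩ := integral_norm_le_of_support isClosed_closure.measurableSet hKf v hv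
  have hpt : ∀ᵐ ξ, ‖(𝓕 v : L2 n) ξ‖ ^ 2 ≤
      (Metric.ball (0 : Rn n) r).indicator (fun _ ↦ (‖v‖ * B) ^ 2) ξ + (q⁻¹) ^ 2 * ‖V ξ‖ ^ 2 := by
    filter_upwards [lp_fourier_ae_eq v hvi, hV] with ξ h1 h2
    by_cases hξ : ξ ∈ Metric.ball (0 : Rn n) r
    · rw [indicator_of_mem hξ, h1]
      have : ‖𝓕 (v : Rn n → ℂ) ξ‖ ≤ ‖v‖ * B :=
        (VectorFourier.norm_fourierIntegral_le_integral_norm _ _ _ _ _).trans hvn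
      have h3 : 0 ≤ (q⁻¹) ^ 2 * ‖V ξ‖ ^ 2 := by positivity
      have := pow_le_pow_left₀ (norm_nonneg _) this 2
      linarith
    · rw [indicator_of_notMem hξ, h2, homFourier, zero_add, ← mul_pow]
      have hξ' : r ≤ ‖ξ‖ := by simpa using hξ
      gcongr
      rw [norm_mul, Complex.norm_real, Real.norm_eq_abs, abs_of_nonneg (by positivity), ← mul_assoc]
      refine le_mul_of_one_le_left (norm_nonneg _) ?_
      rw [inv_mul_eq_div, le_div_iff₀ hq0, one_mul]
      calc q = q ^ (1 : ℝ) := by simp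
        _ ≤ q ^ s := Real.rpow_le_rpow_of_exponent_ge hq0 hrpi hs1.le
        _ ≤ _ := Real.rpow_le_rpow hq0.le (by rw [hq]; gcongr) hs0.le
  have hfin : volume (Metric.ball (0 : Rn n) r) ≠ ⊤ := measure_ball_lt_top.ne
  have hint1 : Integrable ((Metric.ball (0 : Rn n) r).indicator fun _ ↦ (‖v‖ * B) ^ 2) :=
    (integrable_indicator_iff measurableSet_ball).2 (integrableOn_const hfin)
  have hint2 := (integrable_norm_sq V).const_mul ((q⁻¹) ^ 2)
  have h3 := integral_mono_ae (integrable_norm_sq (𝓕 v)) (hint1.add hint2) hpt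
  rw [← norm_sq_eq_integral, Lp.norm_fourier_eq] at h3
  simp only [Pi.add_apply] at h3
  rw [integral_add hint1 hint2, integral_indicator measurableSet_ball, setIntegral_const,
    integral_const_mul, ← norm_sq_eq_integral, smul_eq_mul, Measure.real] at h3
  have h4 : (volume (Metric.ball (0 : Rn n) r)).toReal * (‖v‖ * B) ^ 2 ≤ 1 / 2 * ‖v‖ ^ 2 := by
    calc _ ≤ (r * β) * (‖v‖ * B) ^ 2 := by gcongr
      _ = (B ^ 2 * (r * β)) * ‖v‖ ^ 2 := by ring
      _ ≤ _ := by gcongr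
  have h5 : ‖v‖ ^ 2 ≤ (2 / q * ‖V‖) ^ 2 := by
    have : (2 / q * ‖V‖) ^ 2 = 4 * ((q⁻¹) ^ 2 * ‖V‖ ^ 2) := by field_simp; ring
    have h6 : 0 ≤ (q⁻¹) ^ 2 * ‖V‖ ^ 2 := by positivity
    linarith
  exact (pow_le_pow_iff_left₀ (norm_nonneg _) (by positivity) two_ne_zero).1 h5

/-- The graph of `v ↦ |2πξ|^s v̂` on the functions vanishing almost everywhere in `Ω_e`. -/
def testGraph (s : ℝ) (Ω : Set (Rn n)) : Submodule ℂ (L2 n × L2 n) where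
  carrier := {p | (p.2 : Rn n → ℂ) =ᵐ[volume] homFourier s p.1 ∧
    ∀ᵐ x ∂(volume.restrict (exteriorSet Ω)), p.1 x = 0}
  add_mem' := by
    rintro ⟨a, A⟩ ⟨b, B⟩ ⟨h1, h2⟩ ⟨h3, h4⟩
    refine ⟨?_, ?_⟩
    · filter_upwards [h1, h3, homFourier_add s a b, Lp.coeFn_add A B] with ξ k1 k2 k3 k4
      simp_all
    · filter_upwards [h2, h4, ae_restrict_of_ae (Lp.coeFn_add a b)] with ξ k1 k2 k3
      simp_all
  zero_mem' := by
    refine ⟨?_, ?_⟩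
    · have := homFourier_smul s 0 (0 : L2 n)
      filter_upwards [this] with ξ k1
      simp only [zero_smul, Pi.zero_apply] at k1
      simp [k1]
    · exact ae_restrict_of_ae (Lp.coeFn_zero ℂ 2 (volume : Measure (Rn n)))
  smul_mem' := by
    rintro c ⟨a, A⟩ ⟨h1, h2⟩
    refine ⟨?_, ?_⟩
    · filter_upwards [h1, homFourier_smul s c a, Lp.coeFn_smul c A] with ξ k1 k3 k4
      simp_all
    · filter_upwards [h2, ae_restrict_of_ae (Lp.coeFn_smul c a)] with ξ k1 k3
      simp_all

lemma exists_subseq_ae_tendsto {u : ℕ → L2 n} {v : L2 n}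
    (h : Filter.Tendsto u Filter.atTop (nhds v)) :
    ∃ ns : ℕ → ℕ, StrictMono ns ∧
      ∀ᵐ x, Filter.Tendsto (fun i ↦ u (ns i) x) Filter.atTop (nhds (v x)) :=
  (tendstoInMeasure_of_tendsto_Lp h).exists_seq_tendsto_ae

/-- Multiplication by an unbounded weight is a closed operator: along a common subsequence
everything converges pointwise almost everywhere. -/
lemma isClosed_testGraph (s : ℝ) (Ω : Set (Rn n)) : IsClosed (testGraph s Ω : Set (L2 n × L2 n)) := by
  refine IsSeqClosed.isClosed ?_
  rintro p ⟨v, V⟩ hp hlim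
  rw [Prod.tendsto_iff] at hlim
  obtain ⟨h1, h2⟩ := hlim
  have h3 : Filter.Tendsto (fun k ↦ (𝓕 (p k).1 : L2 n)) Filter.atTop (nhds (𝓕 v)) :=
    ((Lp.fourierTransformₗᵢ (Rn n) ℂ).continuous.tendsto v).comp h1
  obtain ⟨a, ha, ha'⟩ := exists_subseq_ae_tendsto h3
  obtain ⟨b, hb, hb'⟩ := exists_subseq_ae_tendsto (h2.comp ha.tendsto_atTop)
  obtain ⟨c, hc, hc'⟩ := exists_subseq_ae_tendsto h1
  refine ⟨?_, ?_⟩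
  · have hall : ∀ᵐ ξ, ∀ k, (p k).2 ξ = homFourier s (p k).1 ξ := ae_all_iff.2 fun k ↦ (hp k).1
    filter_upwards [ha', hb', hall] with ξ k1 k2 k3
    have k4 := (k1.comp hb.tendsto_atTop).const_mul ((((2 * Real.pi * ‖ξ‖) ^ s : ℝ) : ℂ))
    refine tendsto_nhds_unique k2 (k4.congr fun i ↦ ?_)
    simp [k3, homFourier]
  · have hall : ∀ᵐ x ∂(volume.restrict (exteriorSet Ω)), ∀ k, (p k).1 x = 0 :=
      ae_all_iff.2 fun k ↦ (hp k).2
    filter_upwards [ae_restrict_of_ae hc', hall] with x k1 k2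
    refine tendsto_nhds_unique k1 ?_
    simp [k2]

/-- By the Poincaré inequality the second projection is bounded below on the complete graph, so its
range is closed and admits an orthogonal projection. -/
lemma isClosed_map_snd_testGraph {s : ℝ} {Ω : Set (Rn n)} {c : ℝ} (hc : 0 < c)
    (h : ∀ v V : L2 n, (V : Rn n → ℂ) =ᵐ[volume] homFourier s v →
      (∀ᵐ x ∂(volume.restrict (exteriorSet Ω)), v x = 0) → ‖v‖ ≤ c * ‖V‖) :
    IsClosed (((testGraph s Ω).map (LinearMap.snd ℂ (L2 n) (L2 n)) : Submodule ℂ (L2 n)) : Set (L2 n)) := by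
  have : CompleteSpace (testGraph s Ω) := (isClosed_testGraph s Ω).completeSpace_coe
  let T : testGraph s Ω →L[ℂ] L2 n :=
    (ContinuousLinearMap.snd ℂ (L2 n) (L2 n)).comp (testGraph s Ω).subtypeL
  have hT : AntilipschitzWith (max c 1).toNNReal T := by
    refine AddMonoidHomClass.antilipschitz_of_bound T fun p ↦ ?_
    rw [Real.coe_toNNReal _ (by positivity)]
    change max ‖p.1.1‖ ‖p.1.2‖ ≤ max c 1 * ‖p.1.2‖
    refine max_le ((h _ _ p.2.1 p.2.2).trans ?_) ?_
    · gcongr; exact le_max_left _ _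
    · exact le_mul_of_one_le_left (norm_nonneg _) (le_max_right _ _)
  have h2 := hT.isClosed_range T.uniformContinuous
  convert h2 using 1
  ext x
  simp [T]

/-- The exterior value problem is uniquely solvable, and solutions are bounded by the data. -/
theorem exists_wellposed (hn : 1 ≤ n) {Ω : Set (Rn n)} (hΩb : Bornology.IsBounded Ω) :
    ∃ C : ℝ, 0 < C ∧ ∀ s : ℝ, 0 < s → s < 1 → ∀ f : L2 n, MemHs s f →
      (∃! u : L2 n, IsWeakSolution s Ω f u) ∧
      ∀ u : L2 n, IsWeakSolution s Ω f u → ‖u‖ ≤ C * (hsNorm s f).toReal := by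
  obtain ⟨c, hc, hP⟩ := exists_poincare hn hΩb
  refine ⟨1 + c, by positivity, fun s hs0 hs1 f hf ↦ ?_⟩
  have hsub : ∀ a b : L2 n, a - b = a + (-1 : ℂ) • b := fun a b ↦ by simp [sub_eq_add_neg]
  have hdiff : ∀ {a b : L2 n}, MemHs s a → MemHs s b → MemHs s (a - b) := fun ha hb ↦ by
    rw [hsub]; exact ha.add hs0.le hs1.le (hb.smul hs0.le hs1.le _)
  have hhd : ∀ a b : L2 n, homFourier s (a - b) =ᵐ[volume] homFourier s a - homFourier s b := by
    intro a b
    rw [hsub]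
    filter_upwards [homFourier_add s a ((-1 : ℂ) • b), homFourier_smul s (-1) b] with ξ h1 h2
    rw [h1, Pi.add_apply, h2, Pi.sub_apply, Pi.smul_apply, neg_one_smul, sub_eq_add_neg]
  have hD : ∀ {v : L2 n} (hv : MemHs s v),
      ((hv.memLp_homFourier hs0.le).toLp _ : Rn n → ℂ) =ᵐ[volume] homFourier s v :=
    fun hv ↦ MemLp.coeFn_toLp _
  refine ⟨?_, ?_⟩
  · refine existsUnique_of_exists_of_unique ?_ ?_
    · set N := (testGraph s Ω).map (LinearMap.snd ℂ (L2 n) (L2 n)) with hN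
      have : CompleteSpace N :=
        (isClosed_map_snd_testGraph hc (fun v V ↦ hP s hs0 hs1 v V)).completeSpace_coe
      set G := (hf.memLp_homFourier hs0.le).toLp (homFourier s f) with hG
      have hmem : N.starProjection G ∈ N := Submodule.starProjection_apply_mem N G
      obtain ⟨⟨w, V⟩, ⟨hw1, hw2⟩, hw3⟩ := Submodule.mem_map.1 hmem
      simp only [LinearMap.snd_apply] at hw3 hw1 hw2
      have hwHs : MemHs s w := memHs_of_memLp_homFourier hs0.le hs1.le ((Lp.memLp V).ae_eq hw1)
      -- Here `|2πξ|^s ŵ` is the projection of `|2πξ|^s f̂` onto the image of the test space, so the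
      -- residual belonging to `f - w` is orthogonal to that image.
      refine ⟨f - w, hdiff hf hwHs, ?_, ?_⟩
      · filter_upwards [hw2, ae_restrict_of_ae (Lp.coeFn_sub f w)] with x h1 h2
        rw [h2, Pi.sub_apply, h1, sub_zero]
      · intro v hv hv0
        have hU : ((G - V : L2 n) : Rn n → ℂ) =ᵐ[volume] homFourier s (f - w) := by
          filter_upwards [Lp.coeFn_sub G V, hD hf, hw1, hhd f w] with ξ h1 h2 h3 h4
          rw [h1, h4, Pi.sub_apply, Pi.sub_apply, h2, h3]
        rw [fracLaplacePairing_eq_inner hU (hD hv), hw3]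
        refine Submodule.sub_starProjection_mem_orthogonal (K := N) G _ ?_
        exact Submodule.mem_map.2 ⟨(v, _), ⟨hD hv, hv0⟩, rfl⟩
    · intro u v hu hv
      have hd := hdiff hu.memHs hv.memHs
      have hd0 : ∀ᵐ x ∂(volume.restrict (exteriorSet Ω)), (u - v) x = 0 := by
        filter_upwards [hu.exterior, hv.exterior, ae_restrict_of_ae (Lp.coeFn_sub u v)]
          with x h1 h2 h3
        rw [h3, Pi.sub_apply, h1, h2, sub_self]
      have h1 := hu.equation _ hd hd0
      have h2 := hv.equation _ hd hd0
      rw [fracLaplacePairing_eq_inner (hD hu.memHs) (hD hd)] at h1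
      rw [fracLaplacePairing_eq_inner (hD hv.memHs) (hD hd)] at h2
      set U := (hu.memHs.memLp_homFourier hs0.le).toLp (homFourier s u)
      set V := (hv.memHs.memLp_homFourier hs0.le).toLp (homFourier s v)
      have h3 : (hd.memLp_homFourier hs0.le).toLp (homFourier s (u - v)) = U - V := by
        refine Lp.ext ?_
        filter_upwards [hD hd, hhd u v, hD hu.memHs, hD hv.memHs, Lp.coeFn_sub U V]
          with ξ k1 k2 k3 k4 k5
        rw [k1, k2, k5, Pi.sub_apply, Pi.sub_apply, k3, k4]
      -- The difference of two solutions is itself a test function, which makes `U - V` orthogonal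
      -- to itself.
      have h4 : U - V = 0 := by
        rw [h3] at h1 h2
        rw [← inner_self_eq_zero (𝕜 := ℂ), inner_sub_right, h1, h2, sub_zero]
      have h5 := hP s hs0 hs1 (u - v) _ (hD hd) hd0
      rw [h3, h4, norm_zero, mul_zero] at h5
      exact sub_eq_zero.1 (norm_le_zero_iff.1 h5)
  · intro u hu
    have hd := hdiff hu.memHs hf
    have hd0 : ∀ᵐ x ∂(volume.restrict (exteriorSet Ω)), (u - f) x = 0 := by
      filter_upwards [hu.exterior, ae_restrict_of_ae (Lp.coeFn_sub u f)] with x h1 h3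
      rw [h3, Pi.sub_apply, h1, sub_self]
    have h1 := hu.equation _ hd hd0
    rw [fracLaplacePairing_eq_inner (hD hu.memHs) (hD hd)] at h1
    have h5 := hP s hs0 hs1 (u - f) _ (hD hd) hd0
    set U := (hu.memHs.memLp_homFourier hs0.le).toLp (homFourier s u)
    set G := (hf.memLp_homFourier hs0.le).toLp (homFourier s f) with hG
    set D := (hd.memLp_homFourier hs0.le).toLp (homFourier s (u - f))
    have h3 : U = D + G := by
      refine Lp.ext ?_
      filter_upwards [hD hd, hhd u f, hD hu.memHs, hD hf, Lp.coeFn_add D G]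
        with ξ k1 k2 k3 k4 k5
      rw [k5, Pi.add_apply, k1, k2, k3, k4, Pi.sub_apply, sub_add_cancel]
    -- Energy estimate: testing the equation with `u - f` gives `⟪D, D⟫ = -⟪D, G⟫`.
    have h6 : ‖D‖ ≤ ‖G‖ := by
      have h7 : inner ℂ D D = - inner ℂ D G := by
        rw [h3, inner_add_right] at h1
        exact eq_neg_of_add_eq_zero_left h1
      have h8 : ‖D‖ * ‖D‖ ≤ ‖D‖ * ‖G‖ := by
        calc ‖D‖ * ‖D‖ = ‖inner ℂ D D‖ := by simp [inner_self_eq_norm_sq_to_K, sq]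
          _ ≤ _ := by rw [h7, norm_neg]; exact norm_inner_le_norm D G
      by_contra! hlt
      have := norm_nonneg G
      nlinarith
    have h9 : ‖G‖ ≤ (hsNorm s f).toReal := by
      rw [hG, Lp.norm_toLp]
      exact ENNReal.toReal_mono hf.ne (eLpNorm_homFourier_le hs0.le f)
    have h10 := norm_le_hsNorm hs0.le hf
    calc ‖u‖ = ‖f + (u - f)‖ := by simp
      _ ≤ ‖f‖ + ‖u - f‖ := norm_add_le _ _
      _ ≤ (hsNorm s f).toReal + c * (hsNorm s f).toReal := by
          gcongr
          exact h5.trans (by gcongr; exact h6.trans h9)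
      _ = _ := by ring

/-! ### Complex Gaussians -/

/-- The quadratic polynomial `-b|y|² + c⟨h, y⟩ + d`. -/
def quadPoly (b : ℝ) (c d : ℂ) (h y : Rn n) : ℂ :=
  -((b * ‖y‖ ^ 2 : ℝ) : ℂ) + c * ((inner ℝ h y : ℝ) : ℂ) + d

lemma contDiff_quadPoly (b : ℝ) (c d : ℂ) (h : Rn n) : ContDiff ℝ ∞ (quadPoly b c d h) := by
  have h1 : ContDiff ℝ ∞ fun y : Rn n ↦ ((b * ‖y‖ ^ 2 : ℝ) : ℂ) :=
    Complex.ofRealCLM.contDiff.comp (contDiff_const.mul (contDiff_norm_sq ℝ))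
  have h2 : ContDiff ℝ ∞ fun y : Rn n ↦ ((inner ℝ h y : ℝ) : ℂ) :=
    Complex.ofRealCLM.contDiff.comp (contDiff_const.inner ℝ contDiff_id)
  exact (h1.neg.add (contDiff_const.mul h2)).add contDiff_const

/-- The inner product as a complex-valued bilinear map. -/
def innerC : Rn n →L[ℝ] Rn n →L[ℝ] ℂ :=
  (ContinuousLinearMap.compL ℝ (Rn n) ℝ ℂ Complex.ofRealCLM).comp (innerSL ℝ)

lemma innerC_apply (x y : Rn n) : innerC x y = ((inner ℝ x y : ℝ) : ℂ) := by
  simp [innerC]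

lemma norm_innerC_apply_le (x : Rn n) : ‖innerC x‖ ≤ ‖x‖ := by
  refine ContinuousLinearMap.opNorm_le_bound _ (norm_nonneg _) fun y ↦ ?_
  rw [innerC_apply, Complex.norm_real]
  exact norm_inner_le_norm x y

lemma norm_innerC_le : ‖(innerC : Rn n →L[ℝ] Rn n →L[ℝ] ℂ)‖ ≤ 1 := by
  refine ContinuousLinearMap.opNorm_le_bound _ zero_le_one fun y ↦ ?_
  simpa using norm_innerC_apply_le y

lemma fderiv_quadPoly (b : ℝ) (c d : ℂ) (h : Rn n) :
    fderiv ℝ (quadPoly b c d h) = fun y ↦ (-(2 * b)) • innerC y + c • innerC h := by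
  funext y
  have h1 : HasFDerivAt (fun y : Rn n ↦ ((b * ‖y‖ ^ 2 : ℝ) : ℂ)) ((2 * b) • innerC y) y := by
    have := Complex.ofRealCLM.hasFDerivAt.comp y
      (((hasStrictFDerivAt_norm_sq y).hasFDerivAt).const_mul b)
    refine this.congr_fderiv ?_
    ext z
    simp [innerC_apply]
    ring
  have h2 : HasFDerivAt (fun y : Rn n ↦ ((inner ℝ h y : ℝ) : ℂ)) (innerC h) y := by
    have := (innerC h).hasFDerivAt (x := y)
    refine this.congr_of_eventuallyEq (Filter.Eventually.of_forall fun z ↦ ?_)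
    simp [innerC_apply]
  have h3 := ((h1.neg.add (h2.const_mul c)).add_const d).fderiv
  exact h3.trans (by ext z; simp)

/-- Only the first two derivatives are nonzero. The form `D ^ i` is the one required by the
composition estimate `norm_iteratedFDeriv_comp_le`; the summand `1` lets `D ^ 2` dominate the second
derivative. -/
lemma norm_iteratedFDeriv_quadPoly_le {b : ℝ} (hb : 0 ≤ b) (c d : ℂ) (h y : Rn n) {i : ℕ}
    (hi : 1 ≤ i) :
    ‖iteratedFDeriv ℝ i (quadPoly b c d h) y‖ ≤
      (2 * b * ‖y‖ + ‖c‖ * ‖h‖ + 2 * b + 1) ^ i := by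
  have hD0 : 0 ≤ 2 * b * ‖y‖ + ‖c‖ * ‖h‖ + 2 * b := by positivity
  have h2 : fderiv ℝ (fun y : Rn n ↦ (-(2 * b)) • innerC y + c • innerC h) =
      fun _ ↦ (-(2 * b)) • innerC := by
    funext y
    exact ((((innerC (n := n)).hasFDerivAt (x := y)).const_smul (-(2 * b))).add_const
      (c • innerC h)).fderiv
  obtain ⟨j, rfl⟩ := Nat.exists_eq_add_of_le' hi
  rw [← norm_iteratedFDeriv_fderiv, fderiv_quadPoly]
  rcases j with _ | j
  · rw [norm_iteratedFDeriv_zero]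
    have k1 : ‖(-(2 * b)) • innerC y‖ ≤ 2 * b * ‖y‖ := by
      rw [norm_smul, norm_neg, Real.norm_of_nonneg (by positivity)]
      gcongr
      exact norm_innerC_apply_le y
    have k2 : ‖c • innerC h‖ ≤ ‖c‖ * ‖h‖ := by
      rw [norm_smul]; gcongr; exact norm_innerC_apply_le h
    have := norm_add_le ((-(2 * b)) • innerC y) (c • innerC h)
    simp only [zero_add, pow_one]
    linarith
  · rw [← norm_iteratedFDeriv_fderiv, h2]
    rcases j with _ | j
    · rw [norm_iteratedFDeriv_zero, norm_smul, norm_neg, Real.norm_of_nonneg (by positivity)]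
      have k1 : 2 * b * ‖(innerC : Rn n →L[ℝ] Rn n →L[ℝ] ℂ)‖ ≤ 2 * b :=
        mul_le_of_le_one_right (by positivity) norm_innerC_le
      have k2 : 0 ≤ 2 * b * ‖y‖ + ‖c‖ * ‖h‖ := by positivity
      simp only [zero_add, Nat.reduceAdd]
      nlinarith [mul_nonneg k2 hb, sq_nonneg (2 * b * ‖y‖ + ‖c‖ * ‖h‖ + 2 * b)]
    · rw [iteratedFDeriv_const_of_ne (by omega)]
      simp only [Pi.zero_apply, norm_zero]
      positivity

lemma norm_iteratedFDeriv_real_cexp (i : ℕ) (z : ℂ) :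
    ‖iteratedFDeriv ℝ i Complex.exp z‖ ≤ ‖Complex.exp z‖ := by
  have h := (Complex.contDiff_exp (𝕜 := ℂ) (n := i)).contDiffAt (x := z)
  rw [← h.restrictScalars_iteratedFDeriv (𝕜 := ℝ)]
  rw [Function.comp_apply]
  change ‖ContinuousMultilinearMap.restrictScalars ℝ (iteratedFDeriv ℂ i Complex.exp z)‖ ≤ _
  rw [ContinuousMultilinearMap.norm_restrictScalars,
    norm_iteratedFDeriv_eq_norm_iteratedDeriv, iteratedDeriv_eq_iterate, Complex.iter_deriv_exp]

lemma norm_iteratedFDeriv_cexp_quadPoly_le {b : ℝ} (hb : 0 ≤ b) (c d : ℂ) (h y : Rn n) (i : ℕ) :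
    ‖iteratedFDeriv ℝ i (fun y ↦ Complex.exp (quadPoly b c d h y)) y‖ ≤
      i.factorial * ‖Complex.exp (quadPoly b c d h y)‖ *
        (2 * b * ‖y‖ + ‖c‖ * ‖h‖ + 2 * b + 1) ^ i :=
  norm_iteratedFDeriv_comp_le (N := ∞) (g := Complex.exp) (f := quadPoly b c d h)
    Complex.contDiff_exp (contDiff_quadPoly b c d h) (by exact_mod_cast le_top) y
    (fun j _ ↦ norm_iteratedFDeriv_real_cexp j _)
    (fun j hj _ ↦ norm_iteratedFDeriv_quadPoly_le hb c d h y hj)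

/-- The power is absorbed in `e^{1+r}`, after which the square is completed in the exponent. -/
lemma pow_mul_exp_le {b : ℝ} (hb : 0 < b) (M : ℝ) (N : ℕ) {r : ℝ} (hr : 0 ≤ r) :
    (1 + r) ^ N * Real.exp (-(b * r ^ 2) + M * r) ≤
      N.factorial * Real.exp (1 + (M + 1) ^ 2 / (4 * b)) := by
  have h1 : (1 + r) ^ N ≤ N.factorial * Real.exp (1 + r) := by
    have := Real.pow_div_factorial_le_exp (1 + r) (by linarith) N
    rwa [div_le_iff₀' (by positivity)] at this
  calc _ ≤ (N.factorial * Real.exp (1 + r)) * Real.exp (-(b * r ^ 2) + M * r) := by gcongr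
    _ = N.factorial * Real.exp (1 + r + (-(b * r ^ 2) + M * r)) := by rw [mul_assoc, ← Real.exp_add]
    _ ≤ _ := by
      refine mul_le_mul_of_nonneg_left (Real.exp_le_exp.2 ?_) (by positivity)
      have h2 : (M + 1) ^ 2 / (4 * b) - (M + 1) * r + b * r ^ 2 =
          (2 * b * r - (M + 1)) ^ 2 / (4 * b) := by field_simp; ring
      have h3 : 0 ≤ (2 * b * r - (M + 1)) ^ 2 / (4 * b) := by positivity
      linarith

lemma norm_cexp_quadPoly_le (b : ℝ) (c d : ℂ) (h y : Rn n) :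
    ‖Complex.exp (quadPoly b c d h y)‖ ≤
      Real.exp (-(b * ‖y‖ ^ 2) + ‖c‖ * ‖h‖ * ‖y‖ + ‖d‖) := by
  rw [Complex.norm_exp]
  gcongr
  simp only [quadPoly, Complex.add_re, Complex.neg_re, Complex.ofReal_re, Complex.re_mul_ofReal]
  have h1 := Complex.re_le_norm d
  have h2 : c.re * inner ℝ h y ≤ ‖c‖ * (‖h‖ * ‖y‖) := by
    refine (le_abs_self _).trans ?_
    rw [abs_mul]
    gcongr
    · exact Complex.abs_re_le_norm c
    · exact abs_real_inner_le_norm h y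
  linarith

/-- The Gaussian `exp (-b|y|² + c⟨h, y⟩ + d)` as a Schwartz function. -/
def gaussianSchwartz {b : ℝ} (hb : 0 < b) (c d : ℂ) (h : Rn n) : 𝓢(Rn n, ℂ) where
  toFun y := Complex.exp (quadPoly b c d h y)
  smooth' := Complex.contDiff_exp.comp (contDiff_quadPoly b c d h)
  decay' k i := by
    set A := 2 * b + ‖c‖ * ‖h‖ + 2 * b + 1 with hA
    refine ⟨i.factorial * A ^ i * Real.exp ‖d‖ * ((k + i).factorial *
      Real.exp (1 + (‖c‖ * ‖h‖ + 1) ^ 2 / (4 * b))), fun y ↦ ?_⟩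
    have h1 := norm_iteratedFDeriv_cexp_quadPoly_le hb.le c d h y i
    have h2 := norm_cexp_quadPoly_le b c d h y
    have h3 : 2 * b * ‖y‖ + ‖c‖ * ‖h‖ + 2 * b + 1 ≤ A * (1 + ‖y‖) := by
      have : 0 ≤ (‖c‖ * ‖h‖ + 2 * b + 1) * ‖y‖ := by positivity
      rw [hA]; nlinarith
    have h4 : ‖y‖ ^ k ≤ (1 + ‖y‖) ^ k := by gcongr; linarith
    calc _ ≤ (1 + ‖y‖) ^ k * (i.factorial *
          Real.exp (-(b * ‖y‖ ^ 2) + ‖c‖ * ‖h‖ * ‖y‖ + ‖d‖) * (A * (1 + ‖y‖)) ^ i) := by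
          gcongr
          exact h1.trans (by gcongr)
      _ = i.factorial * A ^ i * Real.exp ‖d‖ *
          ((1 + ‖y‖) ^ (k + i) * Real.exp (-(b * ‖y‖ ^ 2) + ‖c‖ * ‖h‖ * ‖y‖)) := by
          rw [Real.exp_add _ ‖d‖, mul_pow, pow_add]; ring
      _ ≤ _ := by
          refine mul_le_mul_of_nonneg_left ?_ (by positivity)
          exact pow_mul_exp_le hb _ _ (norm_nonneg y)

@[simp]
lemma gaussianSchwartz_apply {b : ℝ} (hb : 0 < b) (c d : ℂ) (h y : Rn n) :
    gaussianSchwartz hb c d h y = Complex.exp (quadPoly b c d h y) := rfl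

lemma ofReal_norm_sq_eq_sum (x : Rn n) : ((‖x‖ : ℝ) : ℂ) ^ 2 = ∑ i, (x i : ℂ) ^ 2 := by
  rw [← Complex.ofReal_pow, EuclideanSpace.norm_sq_eq]
  simp

lemma ofReal_inner_eq_sum (x y : Rn n) : ((inner ℝ x y : ℝ) : ℂ) = ∑ i, (x i : ℂ) * (y i : ℂ) := by
  simp [PiLp.inner_apply, mul_comm]

lemma integral_cexp_gaussian {b : ℂ} (hb : 0 < b.re) (c : Fin n → ℂ) :
    ∫ v : Rn n, Complex.exp (-b * ∑ i, (v i : ℂ) ^ 2 + ∑ i, c i * v i) =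
      (Real.pi / b) ^ (n / 2 : ℂ) * Complex.exp ((∑ i, c i ^ 2) / (4 * b)) := by
  rw [← (PiLp.volume_preserving_toLp (Fin n)).integral_comp
    (MeasurableEquiv.toLp 2 _).measurableEmbedding]
  simpa using GaussianFourier.integral_cexp_neg_mul_sum_add hb c

/-- The heat kernel at time `t`, with pole continued to the complex point `κ h`. -/
def heatSchwartz {t : ℝ} (ht : 0 < t) (κ : ℂ) (h : Rn n) : 𝓢(Rn n, ℂ) :=
  ((Real.pi / (1 / (4 * t) : ℝ) : ℂ) ^ (n / 2 : ℂ))⁻¹ •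
    gaussianSchwartz (b := 1 / (4 * t)) (by positivity) (κ / (2 * t)) (-(κ ^ 2 * ‖h‖ ^ 2 / (4 * t))) h

/-- The complex Gaussian integral has linear coefficient `κh/(2t) - 2πiξ`; the constant
`-κ²|h|²/(4t)` in the kernel cancels the part of its square that is free of `ξ`, leaving the heat
multiplier and the phase of a translation by `κh`. -/
lemma fourier_heatSchwartz {t : ℝ} (ht : 0 < t) (κ : ℂ) (h ξ : Rn n) :
    𝓕 (heatSchwartz ht κ h) ξ = Complex.exp (-((t * (2 * Real.pi * ‖ξ‖) ^ 2 : ℝ) : ℂ)) *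
      Complex.exp (-(2 * Real.pi * Complex.I * κ * ((inner ℝ h ξ : ℝ) : ℂ))) := by
  have ht' : (t : ℂ) ≠ 0 := by exact_mod_cast ht.ne'
  have hb : 0 < (((1 / (4 * t) : ℝ) : ℂ)).re := by rw [Complex.ofReal_re]; positivity
  have hZ : (Real.pi / (1 / (4 * t) : ℝ) : ℂ) ^ (n / 2 : ℂ) ≠ 0 := by
    rw [Complex.cpow_ne_zero_iff]
    left
    rw [← Complex.ofReal_div]
    exact_mod_cast (by positivity : Real.pi / (1 / (4 * t)) ≠ 0)
  rw [SchwartzMap.fourier_coe, Real.fourier_eq']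
  set Z := (Real.pi / (1 / (4 * t) : ℝ) : ℂ) ^ (n / 2 : ℂ) with hZdef
  have key := integral_cexp_gaussian hb
    (fun i : Fin n ↦ κ / (2 * t) * (h i : ℂ) - 2 * Real.pi * Complex.I * (ξ i : ℂ))
  have hsum : (∑ i, (κ / (2 * t) * (h i : ℂ) - 2 * Real.pi * Complex.I * (ξ i : ℂ)) ^ 2) /
      (4 * ((1 / (4 * t) : ℝ) : ℂ)) = κ ^ 2 * ‖h‖ ^ 2 / (4 * t) +
        (-((t * (2 * Real.pi * ‖ξ‖) ^ 2 : ℝ) : ℂ) -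
          2 * Real.pi * Complex.I * κ * ((inner ℝ h ξ : ℝ) : ℂ)) := by
    have e1 : ∑ i, (κ / (2 * t) * (h i : ℂ) - 2 * Real.pi * Complex.I * (ξ i : ℂ)) ^ 2 =
        (κ / (2 * t)) ^ 2 * (‖h‖ : ℂ) ^ 2 -
          2 * (κ / (2 * t)) * (2 * Real.pi * Complex.I) * ((inner ℝ h ξ : ℝ) : ℂ) +
          (2 * Real.pi * Complex.I) ^ 2 * (‖ξ‖ : ℂ) ^ 2 := by
      rw [ofReal_norm_sq_eq_sum, ofReal_norm_sq_eq_sum, ofReal_inner_eq_sum, Finset.mul_sum,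
        Finset.mul_sum, Finset.mul_sum, ← Finset.sum_sub_distrib, ← Finset.sum_add_distrib]
      refine Finset.sum_congr rfl fun i _ ↦ ?_
      ring
    rw [e1]
    push_cast
    field_simp
    rw [Complex.I_sq]
    ring
  rw [hsum] at key
  have hint : ∀ v : Rn n, Complex.exp (((-2 * Real.pi * inner ℝ v ξ : ℝ) : ℂ) * Complex.I) •
      heatSchwartz ht κ h v = Z⁻¹ * Complex.exp (-(κ ^ 2 * ‖h‖ ^ 2 / (4 * t))) *
        Complex.exp (-((1 / (4 * t) : ℝ) : ℂ) * ∑ i, (v i : ℂ) ^ 2 +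
          ∑ i, (κ / (2 * t) * (h i : ℂ) - 2 * Real.pi * Complex.I * (ξ i : ℂ)) * v i) := by
    intro v
    have e2 : ∑ i, (κ / (2 * t) * (h i : ℂ) - 2 * Real.pi * Complex.I * (ξ i : ℂ)) * v i =
        κ / (2 * t) * ((inner ℝ h v : ℝ) : ℂ) -
          2 * Real.pi * Complex.I * ((inner ℝ v ξ : ℝ) : ℂ) := by
      rw [ofReal_inner_eq_sum, ofReal_inner_eq_sum, Finset.mul_sum, Finset.mul_sum,
        ← Finset.sum_sub_distrib]
      refine Finset.sum_congr rfl fun i _ ↦ ?_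
      ring
    rw [e2, ← ofReal_norm_sq_eq_sum, heatSchwartz, _root_.smul_apply, gaussianSchwartz_apply,
      smul_eq_mul, smul_eq_mul, ← hZdef, mul_left_comm, ← Complex.exp_add, mul_assoc Z⁻¹,
      ← Complex.exp_add]
    congr 2
    rw [quadPoly]
    push_cast
    ring
  simp_rw [hint]
  rw [integral_const_mul, key, ← Complex.exp_add, Complex.exp_add _ (_ - _), ← hZdef, Complex.exp_neg,
    sub_eq_add_neg]
  field_simp

/-! ### Local bounds for the heat flow of `(-Δ)^s u` -/

open scoped Laplacian in
lemma fourier_sub_laplacian (w : 𝓢(Rn n, ℂ)) (ξ : Rn n) :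
    𝓕 (w - Δ w) ξ = ((1 + (2 * Real.pi * ‖ξ‖) ^ 2 : ℝ) : ℂ) * 𝓕 w ξ := by
  have h1 : (𝓕 (w - Δ w) : 𝓢(Rn n, ℂ)) = 𝓕 w - 𝓕 (Δ w) := by
    rw [sub_eq_add_neg, sub_eq_add_neg, FourierTransform.fourier_add]
    congr 1
    rw [← neg_one_smul ℂ, FourierTransform.fourier_smul, neg_one_smul]
  have ht : (fun x : Rn n ↦ ‖x‖ ^ 2).HasTemperateGrowth := by fun_prop
  rw [h1, SchwartzMap.laplacian_eq_fourierMultiplierCLM, neg_smul, ← neg_one_smul ℂ,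
    FourierTransform.fourier_smul, ← Complex.coe_smul, FourierTransform.fourier_smul,
    SchwartzMap.fourierMultiplierCLM_apply, FourierTransform.fourier_fourierInv_eq]
  simp only [_root_.sub_apply, _root_.smul_apply, SchwartzMap.smulLeftCLM_apply_apply ht, smul_eq_mul]
  simp only [Complex.real_smul]
  push_cast
  ring

lemma integral_norm_mul_norm_le (f g : L2 n) :
    Integrable (fun x ↦ ‖f x‖ * ‖g x‖) ∧ ∫ x, ‖f x‖ * ‖g x‖ ≤ ‖f‖ * ‖g‖ := by
  have hf := (Lp.memLp f).norm
  have hg := (Lp.memLp g).norm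
  refine ⟨hf.integrable_mul hg, ?_⟩
  have h := integral_mul_norm_le_Lp_mul_Lq (p := 2) (q := 2) (f := (f : Rn n → ℂ))
    (g := (g : Rn n → ℂ)) (μ := volume) Real.HolderConjugate.two_two
    (by simpa using Lp.memLp f) (by simpa using Lp.memLp g)
  simp only [Real.rpow_two, ← norm_sq_eq_integral, ← Real.sqrt_eq_rpow] at h
  simpa [Real.sqrt_sq] using h

lemma freq_rpow_two_mul_le {s : ℝ} (hs : 0 ≤ s) (hs1 : s ≤ 1) (ξ : Rn n) :
    (2 * Real.pi * ‖ξ‖) ^ (2 * s) ≤ 1 + (2 * Real.pi * ‖ξ‖) ^ 2 := by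
  have h0 : 0 ≤ 2 * Real.pi * ‖ξ‖ := by positivity
  rcases le_total (2 * Real.pi * ‖ξ‖) 1 with h | h
  · have := Real.rpow_le_one h0 h (by linarith : 0 ≤ 2 * s)
    nlinarith
  · have := Real.rpow_le_rpow_of_exponent_le h (by push_cast; linarith : 2 * s ≤ (2 : ℕ))
    rw [Real.rpow_natCast] at this
    linarith

open scoped Laplacian in
-- For every `s ∈ [0, 1]` the symbol `|2πξ|^{2s}` is dominated by the symbol of `1 - Δ`. This
-- replaces the nonlocal operator by a local one, whose size can be read off pointwise in space.
lemma norm_pairing_schwartz_le {s : ℝ} (hs : 0 ≤ s) (hs1 : s ≤ 1) (F : L2 n) (w : 𝓢(Rn n, ℂ)) :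
    Integrable (fun ξ : Rn n ↦ (((2 * Real.pi * ‖ξ‖) ^ (2 * s) : ℝ) : ℂ) *
      (F ξ * starRingEnd ℂ (𝓕 w ξ))) ∧
    ‖∫ ξ : Rn n, (((2 * Real.pi * ‖ξ‖) ^ (2 * s) : ℝ) : ℂ) *
      (F ξ * starRingEnd ℂ (𝓕 w ξ))‖ ≤ ‖F‖ * ‖(w - Δ w).toLp 2 (volume : Measure (Rn n))‖ := by
  set G : L2 n := 𝓕 ((w - Δ w).toLp 2 (volume : Measure (Rn n))) with hG
  have hG' : (G : Rn n → ℂ) =ᵐ[volume] (𝓕 (w - Δ w) : 𝓢(Rn n, ℂ)) := by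
    rw [hG, SchwartzMap.toLp_fourier_eq]
    exact SchwartzMap.coeFn_toLp _ _ _
  obtain ⟨h1, h2⟩ := integral_norm_mul_norm_le F G
  rw [hG, Lp.norm_fourier_eq, ← hG] at h2
  have hle : ∀ᵐ ξ : Rn n, ‖(((2 * Real.pi * ‖ξ‖) ^ (2 * s) : ℝ) : ℂ) *
      (F ξ * starRingEnd ℂ (𝓕 w ξ))‖ ≤ ‖F ξ‖ * ‖G ξ‖ := by
    filter_upwards [hG'] with ξ h
    rw [h, fourier_sub_laplacian]
    simp only [norm_mul, Complex.norm_real, RCLike.norm_conj]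
    rw [Real.norm_of_nonneg (by positivity), Real.norm_of_nonneg (by positivity), mul_left_comm]
    gcongr
    exact freq_rpow_two_mul_le hs hs1 ξ
  have hmeas : AEStronglyMeasurable (fun ξ : Rn n ↦ (((2 * Real.pi * ‖ξ‖) ^ (2 * s) : ℝ) : ℂ) *
      (F ξ * starRingEnd ℂ (𝓕 w ξ))) volume := by
    refine AEStronglyMeasurable.mul ?_ ((Lp.aestronglyMeasurable F).mul ?_)
    · exact (Complex.measurable_ofReal.comp (measurable_freq_rpow _)).aestronglyMeasurable
    · exact (Complex.continuous_conj.comp (𝓕 w).continuous).aestronglyMeasurable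
  have hint := h1.mono' hmeas hle
  refine ⟨hint, (norm_integral_le_integral_norm _).trans
    ((integral_mono_ae hint.norm h1 hle).trans h2)⟩

lemma integrable_gaussian {b : ℝ} (hb : 0 < b) :
    Integrable (fun y : Rn n ↦ Real.exp (-(b * ‖y‖ ^ 2))) := by
  have := (GaussianFourier.integrable_cexp_neg_mul_sq_norm_add (V := Rn n) (b := (b : ℂ))
    (by simpa using hb) 0 0).norm
  refine this.congr (Filter.Eventually.of_forall fun y ↦ ?_)
  simp only [Complex.norm_exp]
  congr 1
  simp [← Complex.ofReal_pow]

lemma norm_toLp_le_of_gaussian (w : 𝓢(Rn n, ℂ)) {B b : ℝ} (hB : 0 ≤ B) (hb : 0 < b)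
    (h : ∀ y, ‖w y‖ ≤ B * Real.exp (-(b * ‖y‖ ^ 2))) :
    ‖w.toLp 2 (volume : Measure (Rn n))‖ ≤
      B * Real.sqrt (∫ y : Rn n, Real.exp (-(2 * b * ‖y‖ ^ 2))) := by
  have h2 := (integrable_gaussian (n := n) (b := 2 * b) (by positivity)).const_mul (B ^ 2)
  refine (pow_le_pow_iff_left₀ (norm_nonneg _) (by positivity) two_ne_zero).1 ?_
  rw [norm_sq_eq_integral, mul_pow, Real.sq_sqrt (integral_nonneg fun y ↦ by positivity),
    ← integral_const_mul]
  refine integral_mono_ae (integrable_norm_sq _) h2 ?_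
  filter_upwards [w.coeFn_toLp 2 (volume : Measure (Rn n))] with y hy
  rw [hy]
  calc ‖w y‖ ^ 2 ≤ (B * Real.exp (-(b * ‖y‖ ^ 2))) ^ 2 := by gcongr; exact h y
    _ = _ := by
      rw [mul_pow, ← Real.exp_nat_mul]
      congr 2
      push_cast
      ring

open scoped Laplacian in
lemma norm_laplacian_le (w : 𝓢(Rn n, ℂ)) (y : Rn n) :
    ‖(Δ w) y‖ ≤ n * ‖iteratedFDeriv ℝ 2 w y‖ := by
  rw [SchwartzMap.laplacian_apply,
    InnerProductSpace.laplacian_eq_iteratedFDeriv_orthonormalBasis w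
      (EuclideanSpace.basisFun (Fin n) ℝ)]
  refine (norm_sum_le _ _).trans ?_
  calc _ ≤ ∑ _i : Fin n, ‖iteratedFDeriv ℝ 2 w y‖ := by
        refine Finset.sum_le_sum fun i _ ↦ ?_
        refine (ContinuousMultilinearMap.le_opNorm _ _).trans ?_
        simp [Fin.prod_univ_two]
    _ = _ := by simp

lemma norm_heat_const_le {t : ℝ} (ht : 0 < t) :
    ‖((Real.pi / (1 / (4 * t) : ℝ) : ℂ) ^ (n / 2 : ℂ))⁻¹‖ ≤ (1 + 1 / t) ^ n := by
  have hpi := Real.pi_gt_three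
  have e : (Real.pi / (1 / (4 * t) : ℝ) : ℂ) = ((Real.pi / (1 / (4 * t)) : ℝ) : ℂ) := by push_cast; rfl
  have e2 : (n / 2 : ℂ) = ((n / 2 : ℝ) : ℂ) := by push_cast; rfl
  rw [norm_inv, e, e2, Complex.norm_cpow_eq_rpow_re_of_pos (by positivity), Complex.ofReal_re,
    ← Real.inv_rpow (by positivity)]
  have h1 : (Real.pi / (1 / (4 * t)))⁻¹ ≤ 1 + 1 / t := by
    rw [inv_le_comm₀ (by positivity) (by positivity)]
    have : (1 + 1 / t)⁻¹ ≤ t := by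
      rw [inv_le_comm₀ (by positivity) ht, ← one_div]; linarith
    refine this.trans ?_
    field_simp
    nlinarith
  calc _ ≤ (1 + 1 / t) ^ (n / 2 : ℝ) := by gcongr
    _ ≤ (1 + 1 / t) ^ (n : ℝ) := by
      refine Real.rpow_le_rpow_of_exponent_le ?_ ?_
      · have : 0 < 1 / t := by positivity
        linarith
      · have : (0 : ℝ) ≤ n := Nat.cast_nonneg n
        linarith
    _ = _ := Real.rpow_natCast _ _

/-- When `|y| ≥ 4|h|`, moving the pole to `κh` costs only part of the Gaussian exponent: `|y|²/(4t)`
degrades to no worse than `|y|²/(16t)`. -/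
lemma norm_iteratedFDeriv_heat_le {t : ℝ} (ht : 0 < t) {κ : ℂ} (hκ : ‖κ‖ ≤ 1) {h y : Rn n}
    (hy : 4 * ‖h‖ ≤ ‖y‖) (hh : ‖h‖ ≤ 1) (i : ℕ) :
    ‖iteratedFDeriv ℝ i (heatSchwartz ht κ h) y‖ ≤ i.factorial * ((1 + 1 / t) ^ n *
      Real.exp (-(‖y‖ ^ 2 / (16 * t)))) * ((1 + ‖y‖) * (1 + 1 / t)) ^ i := by
  set b : ℝ := 1 / (4 * t) with hb
  have hb0 : 0 < b := by positivity
  set c : ℂ := κ / (2 * t) with hc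
  set d : ℂ := -(κ ^ 2 * ‖h‖ ^ 2 / (4 * t)) with hd
  have hcn : ‖c‖ ≤ 1 / (2 * t) := by
    rw [hc, norm_div, norm_mul, Complex.norm_real, Complex.norm_ofNat, Real.norm_of_nonneg ht.le]
    gcongr
  have hdn : ‖d‖ ≤ ‖h‖ ^ 2 / (4 * t) := by
    rw [hd, norm_neg, norm_div, norm_mul, norm_mul, norm_pow, norm_pow, Complex.norm_real,
      Complex.norm_real, Complex.norm_ofNat, Real.norm_of_nonneg ht.le, norm_norm]
    gcongr
    exact mul_le_of_le_one_left (by positivity) (pow_le_one₀ (norm_nonneg _) hκ)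
  have h1 : iteratedFDeriv ℝ i (heatSchwartz ht κ h) y =
      ((Real.pi / (1 / (4 * t) : ℝ) : ℂ) ^ (n / 2 : ℂ))⁻¹ •
        iteratedFDeriv ℝ i (fun y ↦ Complex.exp (quadPoly b c d h y)) y :=
    iteratedFDeriv_const_smul_apply
      ((Complex.contDiff_exp.comp (contDiff_quadPoly b c d h)).of_le
        (by exact_mod_cast le_top)).contDiffAt
  rw [h1, norm_smul]
  have h2 := norm_iteratedFDeriv_cexp_quadPoly_le hb0.le c d h y i
  have h3 : ‖Complex.exp (quadPoly b c d h y)‖ ≤ Real.exp (-(‖y‖ ^ 2 / (16 * t))) := by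
    refine (norm_cexp_quadPoly_le b c d h y).trans (Real.exp_le_exp.2 ?_)
    have k1 : ‖c‖ * ‖h‖ * ‖y‖ ≤ 1 / (2 * t) * (‖y‖ / 4) * ‖y‖ := by gcongr; linarith
    have k2 : ‖h‖ ^ 2 / (4 * t) ≤ (‖y‖ / 4) ^ 2 / (4 * t) := by gcongr; linarith
    have k3 : -(b * ‖y‖ ^ 2) + 1 / (2 * t) * (‖y‖ / 4) * ‖y‖ + (‖y‖ / 4) ^ 2 / (4 * t) =
        -(‖y‖ ^ 2 / (16 * t)) - 3 * (‖y‖ ^ 2 / (64 * t)) := by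
      rw [hb]; field_simp; ring
    have k4 : 0 ≤ ‖y‖ ^ 2 / (64 * t) := by positivity
    linarith
  have h4 : 2 * b * ‖y‖ + ‖c‖ * ‖h‖ + 2 * b + 1 ≤ (1 + ‖y‖) * (1 + 1 / t) := by
    have k1 : ‖c‖ * ‖h‖ ≤ 1 / (2 * t) * 1 := by gcongr
    have k2 : 2 * b = 1 / t / 2 := by rw [hb]; field_simp; norm_num
    have k3 : 1 / (2 * t) = 1 / t / 2 := by field_simp
    have k4 : 0 ≤ 1 / t := by positivity
    rw [k3] at k1
    rw [k2]
    nlinarith [mul_nonneg k4 (norm_nonneg y), norm_nonneg y]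
  calc _ ≤ (1 + 1 / t) ^ n * (i.factorial * Real.exp (-(‖y‖ ^ 2 / (16 * t))) *
        ((1 + ‖y‖) * (1 + 1 / t)) ^ i) := by
        gcongr
        · exact norm_heat_const_le ht
        · exact h2.trans (by gcongr)
    _ = _ := by ring

/-- Uniform bound in time for the quantities which arise from derivatives of the heat kernel away
from the diagonal. -/
lemma exists_heat_decay {δ : ℝ} (hδ : 0 < δ) (N : ℕ) :
    ∃ C : ℝ, 0 < C ∧ ∀ t r : ℝ, 0 < t → t ≤ 2 → δ ≤ r →
      (1 + 1 / t) ^ N * (1 + r) ^ 2 * Real.exp (-(r ^ 2 / (16 * t))) ≤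
        C * Real.exp (-(1 / 128 * r ^ 2)) := by
  -- Half of the exponent `r²/(16t)`, with `r ≥ δ`, beats the powers of `1/t`. The other half is at
  -- least `r²/64` because `t ≤ 2`: one `r²/128` absorbs `(1 + r)²` and the other survives.
  set β : ℝ := δ ^ 2 / 32 with hβ
  have hβ0 : 0 < β := by positivity
  set C1 : ℝ := N.factorial / β ^ N * Real.exp β with hC1
  set C2 : ℝ := (2 : ℕ).factorial * Real.exp (1 + (0 + 1) ^ 2 / (4 * (1 / 128 : ℝ))) with hC2
  refine ⟨C1 * C2, by positivity, fun t r ht ht2 hr ↦ ?_⟩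
  have hr0 : 0 < r := hδ.trans_le hr
  set T := 1 / t with hT
  have hT0 : 0 < T := by positivity
  have hT2 : 1 / 2 ≤ T := one_div_le_one_div_of_le ht ht2
  have h1 : (1 + T) ^ N * Real.exp (-(β * T)) ≤ C1 := by
    have := Real.pow_div_factorial_le_exp (β * (1 + T)) (by positivity) N
    rw [div_le_iff₀' (by positivity), mul_pow] at this
    have h2 : (1 + T) ^ N ≤ N.factorial / β ^ N * Real.exp (β * (1 + T)) := by
      rw [div_mul_eq_mul_div, le_div_iff₀' (by positivity)]
      exact this
    calc _ ≤ N.factorial / β ^ N * Real.exp (β * (1 + T)) * Real.exp (-(β * T)) := by gcongr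
      _ = C1 := by
        rw [hC1, mul_assoc, ← Real.exp_add]; congr 2; ring
  have h2 : (1 + r) ^ 2 * Real.exp (-(1 / 128 * r ^ 2) + 0 * r) ≤ C2 :=
    pow_mul_exp_le (by norm_num) 0 2 hr0.le
  have h3 : Real.exp (-(r ^ 2 / (16 * t))) ≤ Real.exp (-(β * T)) *
      (Real.exp (-(1 / 128 * r ^ 2) + 0 * r) * Real.exp (-(1 / 128 * r ^ 2))) := by
    rw [← Real.exp_add, ← Real.exp_add]
    refine Real.exp_le_exp.2 ?_
    have k1 : r ^ 2 / (16 * t) = r ^ 2 * T / 32 + r ^ 2 * T / 32 := by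
      rw [hT]; field_simp; norm_num
    have k2 : β * T ≤ r ^ 2 * T / 32 := by
      rw [hβ]
      have : δ ^ 2 ≤ r ^ 2 := by gcongr
      nlinarith
    have k3 : r ^ 2 / 64 ≤ r ^ 2 * T / 32 := by nlinarith [sq_nonneg r]
    rw [k1]
    linarith
  calc _ ≤ (1 + T) ^ N * (1 + r) ^ 2 * (Real.exp (-(β * T)) *
      (Real.exp (-(1 / 128 * r ^ 2) + 0 * r) * Real.exp (-(1 / 128 * r ^ 2)))) := by gcongr
    _ = ((1 + T) ^ N * Real.exp (-(β * T))) *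
        ((1 + r) ^ 2 * Real.exp (-(1 / 128 * r ^ 2) + 0 * r)) * Real.exp (-(1 / 128 * r ^ 2)) := by
        ring
    _ ≤ _ := by gcongr

/-- `F = û` satisfies `(-Δ)^s u = 0` in the ball of radius `δ` about the origin. -/
def FracHarmonicNearZero (s δ : ℝ) (F : L2 n) : Prop :=
  ∀ φ : 𝓢(Rn n, ℂ), HasCompactSupport φ → tsupport φ ⊆ Metric.ball 0 δ →
    ∫ ξ : Rn n, (((2 * Real.pi * ‖ξ‖) ^ (2 * s) : ℝ) : ℂ) * (F ξ * starRingEnd ℂ (𝓕 φ ξ)) = 0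

lemma exists_cutoff {δ : ℝ} (hδ : 0 < δ) : ∃ χ : 𝓢(Rn n, ℂ), HasCompactSupport χ ∧
    tsupport χ ⊆ Metric.ball 0 δ ∧ ∀ y ∈ Metric.ball (0 : Rn n) (δ / 2), χ y = 1 := by
  let b : ContDiffBump (0 : Rn n) := ⟨δ / 2, 3 * δ / 4, by positivity, by linarith⟩
  obtain ⟨χ, hχ⟩ := exists_schwartz_of_compactSupport b.contDiff b.hasCompactSupport
  have hsupp : tsupport χ ⊆ tsupport b := by
    refine closure_mono fun y hy ↦ ?_
    simpa [hχ] using hy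
  refine ⟨χ, b.hasCompactSupport.of_isClosed_subset (isClosed_tsupport _) hsupp, ?_, fun y hy ↦ ?_⟩
  · refine hsupp.trans ?_
    rw [b.tsupport_eq]
    exact Metric.closedBall_subset_ball (by change 3 * δ / 4 < δ; linarith)
  · rw [hχ, b.one_of_mem_closedBall (Metric.ball_subset_closedBall hy)]
    simp

open scoped Laplacian in
-- The function `w = (1 - χ)v` vanishes for `|y| < δ/2`, while `|h| ≤ δ/8` gives `|y| ≥ 4|h|`
-- elsewhere, so the off-diagonal heat kernel bounds apply.
lemma exists_cutoff_heat_bound {δ : ℝ} (hδ : 0 < δ) (χ : 𝓢(Rn n, ℂ))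
    (hχ : ∀ y ∈ Metric.ball (0 : Rn n) (δ / 2), χ y = 1) :
    ∃ C : ℝ, 0 < C ∧ ∀ t : ℝ, ∀ ht : 0 < t, t ≤ 2 → ∀ κ : ℂ, ‖κ‖ ≤ 1 → ∀ h : Rn n, ‖h‖ ≤ δ / 8 →
      ‖h‖ ≤ 1 → ∀ w : 𝓢(Rn n, ℂ),
      (∀ y, w y = heatSchwartz ht κ h y - χ y * heatSchwartz ht κ h y) →
      ‖(w - Δ w).toLp 2 (volume : Measure (Rn n))‖ ≤ C := by
  -- The exponent counts `n` powers of `1 + 1/t` from the normalization of the kernel and two from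
  -- its second derivatives.
  obtain ⟨C0, hC0, hdecay⟩ := exists_heat_decay (half_pos hδ) (n + 2)
  obtain ⟨A, hA0, hA⟩ : ∃ A : ℝ, 0 ≤ A ∧ ∀ i ≤ 2, ∀ y, ‖iteratedFDeriv ℝ i χ y‖ ≤ A := by
    refine ⟨∑ i ∈ Finset.range 3, SchwartzMap.seminorm ℝ 0 i χ,
      Finset.sum_nonneg fun i _ ↦ apply_nonneg _ _, fun i hi y ↦ ?_⟩
    refine (SchwartzMap.norm_iteratedFDeriv_le_seminorm ℝ χ i y).trans ?_
    exact Finset.single_le_sum (f := fun i ↦ SchwartzMap.seminorm ℝ 0 i χ)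
      (fun i _ ↦ apply_nonneg _ _) (Finset.mem_range.2 (by omega))
  set K : ℝ := (1 + A) + n * (2 + 8 * A) with hK
  have hK0 : 0 < K := by positivity
  refine ⟨(K * C0) * Real.sqrt (∫ y : Rn n, Real.exp (-(2 * (1 / 128) * ‖y‖ ^ 2))) + 1,
    by positivity, fun t ht ht2 κ hκ h hh hh1 w hw ↦ ?_⟩
  refine (norm_toLp_le_of_gaussian (w - Δ w) (by positivity : 0 ≤ K * C0)
    (by norm_num : (0 : ℝ) < 1 / 128) fun y ↦ ?_).trans (by linarith)
  set v := heatSchwartz ht κ h with hv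
  have hwv : (w : Rn n → ℂ) = fun y ↦ v y - χ y * v y := funext hw
  rcases lt_or_ge ‖y‖ (δ / 2) with hy | hy
  · have h0 : (w : Rn n → ℂ) =ᶠ[nhds y] fun _ ↦ 0 := by
      filter_upwards [Metric.isOpen_ball.mem_nhds (show y ∈ Metric.ball (0 : Rn n) (δ / 2) by
        simpa using hy)] with z hz
      rw [hw, hχ z hz, one_mul, sub_self]
    have h1 : ‖(Δ w) y‖ ≤ 0 := by
      refine (norm_laplacian_le w y).trans ?_
      rw [(h0.iteratedFDeriv ℝ 2).eq_of_nhds, iteratedFDeriv_const_of_ne (by norm_num)]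
      simp
    have h2 : (w - Δ w) y = 0 := by
      rw [_root_.sub_apply, norm_le_zero_iff.1 h1, h0.eq_of_nhds, sub_zero]
    rw [h2, norm_zero]
    positivity
  · have hheat := fun i ↦ norm_iteratedFDeriv_heat_le ht hκ (h := h) (y := y) (by linarith) hh1 i
    set T := 1 / t with hT
    have hT0 : 0 < T := by positivity
    set X := (1 + T) ^ n * Real.exp (-(‖y‖ ^ 2 / (16 * t))) with hX
    have hX0 : 0 ≤ X := by positivity
    set D := (1 + ‖y‖) * (1 + T) with hD
    have hD1 : 1 ≤ D := by
      rw [hD]; nlinarith [norm_nonneg y, mul_nonneg (norm_nonneg y) hT0.le]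
    have hD2 : 1 ≤ D ^ 2 := one_le_pow₀ hD1
    have hDD : D ≤ D ^ 2 := by nlinarith
    have g0 : ‖iteratedFDeriv ℝ 0 v y‖ ≤ X := by simpa using hheat 0
    have g1 : ‖iteratedFDeriv ℝ 1 v y‖ ≤ X * D := by simpa using hheat 1
    have g2 : ‖iteratedFDeriv ℝ 2 v y‖ ≤ 2 * X * D ^ 2 := by simpa using hheat 2
    have g0' : ‖v y‖ ≤ X := by simpa using g0
    have c0 : ‖χ y‖ ≤ A := by simpa using hA 0 (by norm_num) y
    have hwy : ‖w y‖ ≤ (1 + A) * X * D ^ 2 := by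
      calc ‖w y‖ ≤ ‖v y‖ + ‖χ y‖ * ‖v y‖ := by
            rw [hw, ← norm_mul]; exact norm_sub_le _ _
        _ ≤ X + A * X := by gcongr
        _ = (1 + A) * X * 1 := by ring
        _ ≤ _ := by gcongr
    have hsm : ContDiff ℝ 2 v := v.smooth 2
    have hsχ : ContDiff ℝ 2 χ := χ.smooth 2
    have hw2 : ‖iteratedFDeriv ℝ 2 w y‖ ≤ (2 + 8 * A) * X * D ^ 2 := by
      have e1 : iteratedFDeriv ℝ 2 w y =
          iteratedFDeriv ℝ 2 v y - iteratedFDeriv ℝ 2 (fun z ↦ χ z * v z) y := by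
        rw [hwv]
        exact iteratedFDeriv_sub_apply hsm.contDiffAt (hsχ.mul hsm).contDiffAt
      have e2 := norm_iteratedFDeriv_mul_le (N := 2) hsχ hsm y (n := 2) le_rfl
      have e3 : ‖iteratedFDeriv ℝ 2 (fun z ↦ χ z * v z) y‖ ≤ 6 * A * X * D ^ 2 := by
        refine e2.trans ?_
        simp only [Finset.sum_range_succ, Finset.sum_range_zero, zero_add, Nat.choose_zero_right,
          Nat.choose_self, Nat.cast_one, one_mul, Nat.sub_zero, Nat.reduceSub,
          Nat.choose_one_right, Nat.cast_ofNat]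
        have k0 := mul_le_mul (hA 0 (by norm_num) y) g2 (norm_nonneg _) hA0
        have k1 := mul_le_mul (hA 1 (by norm_num) y) g1 (norm_nonneg _) hA0
        have k2 := mul_le_mul (hA 2 le_rfl y) g0 (norm_nonneg _) hA0
        have k3 : A * (X * D) ≤ A * (X * D ^ 2) := by gcongr
        have k4 : A * X ≤ A * (X * D ^ 2) := by gcongr; exact le_mul_of_one_le_right hX0 hD2
        nlinarith
      rw [e1]
      have k5 := norm_sub_le (iteratedFDeriv ℝ 2 v y) (iteratedFDeriv ℝ 2 (fun z ↦ χ z * v z) y)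
      have k6 : 0 ≤ A * X * D ^ 2 := by positivity
      nlinarith
    have hfin : ‖(w - Δ w) y‖ ≤ K * (X * D ^ 2) := by
      rw [_root_.sub_apply]
      refine (norm_sub_le _ _).trans ?_
      have := norm_laplacian_le w y
      calc _ ≤ (1 + A) * X * D ^ 2 + n * ((2 + 8 * A) * X * D ^ 2) := by
            gcongr
            exact this.trans (by gcongr)
        _ = _ := by rw [hK]; ring
    refine hfin.trans ?_
    rw [mul_assoc K]
    refine mul_le_mul_of_nonneg_left ?_ hK0.le
    refine le_of_eq_of_le ?_ (hdecay t ‖y‖ ht ht2 hy)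
    rw [hX, hD, pow_add, mul_pow]
    ring

/-- The heat extension of `(-Δ)^s u` is bounded in a complex neighbourhood of the origin, uniformly
in time, if `(-Δ)^s u` vanishes near the origin. -/
lemma exists_heat_bound {δ : ℝ} (hδ : 0 < δ) : ∃ C : ℝ, 0 < C ∧ ∀ s : ℝ, 0 < s → s < 1 →
    ∀ F : L2 n, FracHarmonicNearZero s δ F → ∀ t : ℝ, 0 < t → t ≤ 2 → ∀ l : ℂ, ‖l‖ ≤ 1 →
    ∀ h : Rn n, ‖h‖ ≤ δ / 8 → ‖h‖ ≤ 1 →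
    ‖∫ ξ : Rn n, (((2 * Real.pi * ‖ξ‖) ^ (2 * s) : ℝ) : ℂ) *
      (F ξ * (Complex.exp (-((t * (2 * Real.pi * ‖ξ‖) ^ 2 : ℝ) : ℂ)) *
        Complex.exp (2 * Real.pi * Complex.I * l * ((inner ℝ h ξ : ℝ) : ℂ))))‖ ≤ C * ‖F‖ := by
  obtain ⟨χ, hχc, hχs, hχ1⟩ := exists_cutoff (n := n) hδ
  obtain ⟨C, hC, hbound⟩ := exists_cutoff_heat_bound hδ χ hχ1
  refine ⟨C, hC, fun s hs0 hs1 F hF t ht ht2 l hl h hh hh1 ↦ ?_⟩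
  -- The pairing conjugates the test function, so the pole is taken at the conjugate parameter.
  set κ : ℂ := starRingEnd ℂ l with hκ
  have hκ1 : ‖κ‖ ≤ 1 := by rw [hκ, RCLike.norm_conj]; exact hl
  set v := heatSchwartz ht κ h with hv
  have hcs : HasCompactSupport (fun y ↦ χ y * v y) := hχc.mul_right
  have hsm : ContDiff ℝ ∞ (fun y ↦ χ y * v y) := χ.smooth'.mul v.smooth'
  let φ : 𝓢(Rn n, ℂ) := hcs.toSchwartzMap hsm
  have hφ : ∀ y, φ y = χ y * v y := fun y ↦ by simp [φ]
  have hφ' : (φ : Rn n → ℂ) = fun y ↦ χ y * v y := funext hφ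
  let w : 𝓢(Rn n, ℂ) := v - φ
  have hb := hbound t ht ht2 κ hκ1 h hh hh1 w fun y ↦ by
    simp only [w, _root_.sub_apply, hφ, hv]
  have hzero := hF φ (by rw [hφ']; exact hcs) (by
    rw [hφ']; exact (closure_mono (Function.support_mul_subset_left _ _)).trans hχs)
  obtain ⟨hi1, -⟩ := norm_pairing_schwartz_le hs0.le hs1.le F φ
  obtain ⟨hi2, hn2⟩ := norm_pairing_schwartz_le hs0.le hs1.le F w
  have hvsum : v = w + φ := by simp [w]
  have e : ∀ ξ : Rn n, (((2 * Real.pi * ‖ξ‖) ^ (2 * s) : ℝ) : ℂ) *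
      (F ξ * (Complex.exp (-((t * (2 * Real.pi * ‖ξ‖) ^ 2 : ℝ) : ℂ)) *
        Complex.exp (2 * Real.pi * Complex.I * l * ((inner ℝ h ξ : ℝ) : ℂ)))) =
      (((2 * Real.pi * ‖ξ‖) ^ (2 * s) : ℝ) : ℂ) * (F ξ * starRingEnd ℂ (𝓕 w ξ)) +
      (((2 * Real.pi * ‖ξ‖) ^ (2 * s) : ℝ) : ℂ) * (F ξ * starRingEnd ℂ (𝓕 φ ξ)) := by
    intro ξ
    have e1 : 𝓕 v ξ = 𝓕 w ξ + 𝓕 φ ξ := by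
      rw [hvsum, FourierTransform.fourier_add]; rfl
    have e2 := fourier_heatSchwartz ht κ h ξ
    rw [← hv, e1] at e2
    rw [← mul_add, ← mul_add, ← map_add, e2, map_mul, ← Complex.exp_conj, ← Complex.exp_conj]
    have e3 : starRingEnd ℂ 2 = 2 := map_ofNat _ 2
    simp [hκ, e3]
  simp_rw [e]
  rw [integral_add hi2 hi1, hzero, add_zero]
  refine hn2.trans ?_
  rw [mul_comm]
  gcongr

/-! ### Uniform bounds for mollifications, by subordination to the heat flow -/

lemma exists_integral_norm_mul_exp_le {c : ℝ} (hc : 0 < c) (M : ℝ) : ∃ B : ℝ, 0 < B ∧ ∀ F : L2 n,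
    Integrable (fun ξ ↦ ‖F ξ‖ * Real.exp (M * (2 * Real.pi * ‖ξ‖) - c * (2 * Real.pi * ‖ξ‖) ^ 2)) ∧
    ∫ ξ, ‖F ξ‖ * Real.exp (M * (2 * Real.pi * ‖ξ‖) - c * (2 * Real.pi * ‖ξ‖) ^ 2) ≤ B * ‖F‖ := by
  set g : Rn n → ℝ := fun ξ ↦
    Real.exp (M * (2 * Real.pi * ‖ξ‖) - c * (2 * Real.pi * ‖ξ‖) ^ 2) with hg
  have hgc : Continuous g := by rw [hg]; fun_prop
  have hint : Integrable (fun ξ ↦ g ξ ^ 2) := by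
    refine ((integrable_gaussian (n := n) (b := c * (2 * Real.pi) ^ 2)
      (by positivity)).const_mul (Real.exp (M ^ 2 / c))).mono'
      (hgc.pow 2).aestronglyMeasurable (Filter.Eventually.of_forall fun ξ ↦ ?_)
    rw [Real.norm_of_nonneg (by positivity), hg, ← Real.exp_nat_mul, ← Real.exp_add]
    refine Real.exp_le_exp.2 ?_
    have h1 : M ^ 2 / c - 2 * M * (2 * Real.pi * ‖ξ‖) + c * (2 * Real.pi * ‖ξ‖) ^ 2 =
        (M - c * (2 * Real.pi * ‖ξ‖)) ^ 2 / c := by field_simp; ring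
    have h2 : 0 ≤ (M - c * (2 * Real.pi * ‖ξ‖)) ^ 2 / c := by positivity
    push_cast
    nlinarith
  have hmem : MemLp (fun ξ ↦ (g ξ : ℂ)) 2 (volume : Measure (Rn n)) := by
    have hm : AEStronglyMeasurable (fun ξ ↦ (g ξ : ℂ)) (volume : Measure (Rn n)) :=
      (Complex.continuous_ofReal.comp hgc).aestronglyMeasurable
    rw [memLp_two_iff_integrable_sq_norm hm]
    simpa using hint
  refine ⟨‖hmem.toLp _‖ + 1, by positivity, fun F ↦ ?_⟩
  obtain ⟨h1, h2⟩ := integral_norm_mul_norm_le F (hmem.toLp _)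
  have h3 : (fun ξ ↦ ‖F ξ‖ * ‖hmem.toLp _ ξ‖) =ᵐ[volume] fun ξ ↦ ‖F ξ‖ * g ξ := by
    filter_upwards [hmem.coeFn_toLp] with ξ h
    rw [h, Complex.norm_real, Real.norm_of_nonneg (Real.exp_pos _).le]
  refine ⟨h1.congr h3, ?_⟩
  rw [← integral_congr_ae h3]
  nlinarith [norm_nonneg F]

lemma norm_cexp_complex_phase_le {l : ℂ} {M : ℝ} (hl : ‖l‖ ≤ M) (h ξ : Rn n) :
    ‖Complex.exp (2 * Real.pi * Complex.I * l * ((inner ℝ h ξ : ℝ) : ℂ))‖ ≤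
      Real.exp (M * ‖h‖ * (2 * Real.pi * ‖ξ‖)) := by
  rw [Complex.norm_exp]
  refine Real.exp_le_exp.2 ((Complex.re_le_norm _).trans ?_)
  simp only [norm_mul, Complex.norm_ofNat, Complex.norm_real, Complex.norm_I, mul_one,
    Real.norm_of_nonneg Real.pi_pos.le]
  have := abs_real_inner_le_norm h ξ
  have hM := (norm_nonneg l).trans hl
  calc 2 * Real.pi * ‖l‖ * ‖inner ℝ h ξ‖ ≤ 2 * Real.pi * M * (‖h‖ * ‖ξ‖) := by
        gcongr; exact this
    _ = _ := by ring

lemma norm_cexp_neg_ofReal (x : ℝ) : ‖Complex.exp (-(x : ℂ))‖ = Real.exp (-x) := by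
  rw [← Complex.ofReal_neg, Complex.norm_exp_ofReal]

lemma integrableOn_rpow_mul_exp {s r : ℝ} (hs : 0 < s) (hr : 0 < r) :
    IntegrableOn (fun t : ℝ ↦ t ^ (s - 1) * Real.exp (-(t * r))) (Ioi 0) := by
  have := integrableOn_rpow_mul_exp_neg_mul_rpow (p := 1) (s := s - 1) (b := r) (by linarith)
    one_pos hr
  refine this.congr_fun (fun t _ ↦ ?_) measurableSet_Ioi
  simp only [Real.rpow_one]
  ring_nf

/-- The subordination identity, applied with `a = 2π|ξ|`: it inverts the symbol of `(-Δ)^s` through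
the heat semigroup. -/
lemma integral_rpow_mul_exp {s a : ℝ} (hs : 0 < s) (ha : 0 < a) :
    a ^ (2 * s) * ∫ t in Ioi (0 : ℝ), t ^ (s - 1) * Real.exp (-(t * a ^ 2)) = Real.Gamma s := by
  have h := Real.integral_rpow_mul_exp_neg_mul_Ioi hs (by positivity : 0 < a ^ 2)
  have e : ∀ t : ℝ, t ^ (s - 1) * Real.exp (-(t * a ^ 2)) =
      t ^ (s - 1) * Real.exp (-(a ^ 2 * t)) := fun t ↦ by rw [mul_comm t]
  simp_rw [e]
  rw [h, ← mul_assoc, Real.rpow_mul ha.le, Real.rpow_two, ← Real.mul_rpow (by positivity)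
    (by positivity), mul_one_div_cancel (by positivity), Real.one_rpow, one_mul]

/-- For `t > 1`, half of the exponent gives `e^{-a²/2}`; the other half leaves a full Gamma
integral, at the price of `2^s ≤ 2`. -/
lemma integral_Ioi_one_le {s a : ℝ} (hs : 0 < s) (hs1 : s < 1) (ha : 0 < a) :
    a ^ (2 * s) * ∫ t in Ioi (1 : ℝ), t ^ (s - 1) * Real.exp (-(t * a ^ 2)) ≤
      2 * Real.Gamma s * Real.exp (-(1 / 2 * a ^ 2)) := by
  have h1 : ∫ t in Ioi (1 : ℝ), t ^ (s - 1) * Real.exp (-(t * a ^ 2)) ≤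
      Real.exp (-(1 / 2 * a ^ 2)) *
        ∫ t in Ioi (0 : ℝ), t ^ (s - 1) * Real.exp (-(t * (a ^ 2 / 2))) := by
    rw [← integral_const_mul]
    have hi := (integrableOn_rpow_mul_exp hs (by positivity : 0 < a ^ 2 / 2)).const_mul
      (Real.exp (-(1 / 2 * a ^ 2)))
    refine (setIntegral_mono_on ((integrableOn_rpow_mul_exp hs (by positivity)).mono_set
      (Ioi_subset_Ioi zero_le_one)) (IntegrableOn.mono_set hi (Ioi_subset_Ioi zero_le_one))
      measurableSet_Ioi fun t ht ↦ ?_).trans (setIntegral_mono_set hi ?_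
        (Ioi_subset_Ioi zero_le_one).eventuallyLE)
    · have ht1 : 1 < t := ht
      rw [mul_left_comm, ← Real.exp_add]
      gcongr
      nlinarith [sq_nonneg a]
    · refine (ae_restrict_iff' measurableSet_Ioi).2 (Filter.Eventually.of_forall fun t ht ↦ ?_)
      have : 0 < t := ht
      simp only [Pi.zero_apply]
      positivity
  have h2 := integral_rpow_mul_exp hs (by positivity : 0 < a / Real.sqrt 2)
  rw [div_pow, Real.sq_sqrt (by norm_num), Real.div_rpow ha.le (by positivity)] at h2
  have h3 : Real.sqrt 2 ^ (2 * s) ≤ 2 := by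
    rw [Real.rpow_mul (by positivity), Real.rpow_two, Real.sq_sqrt (by norm_num)]
    calc (2 : ℝ) ^ s ≤ 2 ^ (1 : ℝ) := Real.rpow_le_rpow_of_exponent_le (by norm_num) hs1.le
      _ = 2 := by norm_num
  have h4 : 0 < Real.sqrt 2 ^ (2 * s) := by positivity
  have hG := Real.Gamma_pos_of_pos hs
  set J := ∫ t in Ioi (0 : ℝ), t ^ (s - 1) * Real.exp (-(t * (a ^ 2 / 2)))
  have h5 : a ^ (2 * s) * J = Real.sqrt 2 ^ (2 * s) * Real.Gamma s := by
    rw [← h2]; field_simp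
  calc _ ≤ a ^ (2 * s) * (Real.exp (-(1 / 2 * a ^ 2)) * J) := by gcongr
    _ = Real.sqrt 2 ^ (2 * s) * Real.Gamma s * Real.exp (-(1 / 2 * a ^ 2)) := by rw [← h5]; ring
    _ ≤ _ := by gcongr

/-- The integral blows up as `s → 0`, but only as fast as `Γ(s)`, since `e^{-t} ≥ e^{-1}` on the
interval. -/
lemma integral_rpow_Ioc_le {s : ℝ} (hs : 0 < s) :
    IntegrableOn (fun t : ℝ ↦ t ^ (s - 1)) (Ioc 0 1) ∧
    ∫ t in Ioc (0 : ℝ) 1, t ^ (s - 1) ≤ Real.exp 1 * Real.Gamma s := by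
  have hi := (integrableOn_rpow_mul_exp hs one_pos).const_mul (Real.exp 1)
  have hi' : IntegrableOn (fun t : ℝ ↦ t ^ (s - 1)) (Ioc 0 1) := by
    rw [← intervalIntegrable_iff_integrableOn_Ioc_of_le zero_le_one]
    exact intervalIntegral.intervalIntegrable_rpow' (by linarith)
  refine ⟨hi', ?_⟩
  have hG := integral_rpow_mul_exp hs one_pos
  simp only [Real.one_rpow, one_mul, one_pow] at hG
  rw [← hG, ← integral_const_mul]
  refine (setIntegral_mono_on hi' (IntegrableOn.mono_set hi Ioc_subset_Ioi_self)
    measurableSet_Ioc fun t ht ↦ ?_).trans (setIntegral_mono_set hi ?_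
      Ioc_subset_Ioi_self.eventuallyLE)
  · rw [mul_left_comm, ← Real.exp_add]
    have : 0 < t := ht.1
    refine le_mul_of_one_le_right (by positivity) (Real.one_le_exp ?_)
    linarith [ht.2]
  · refine (ae_restrict_iff' measurableSet_Ioi).2 (Filter.Eventually.of_forall fun t ht ↦ ?_)
    have : 0 < t := ht
    simp only [Pi.zero_apply]
    positivity

lemma exists_mollified_bound (hn : 1 ≤ n) {δ : ℝ} (hδ : 0 < δ) :
    ∃ C : ℝ, 0 < C ∧ ∀ s : ℝ, 0 < s → s < 1 →
    ∀ F : L2 n, FracHarmonicNearZero s δ F → ∀ ε : ℝ, 0 < ε → ε ≤ 1 → ∀ l : ℂ, ‖l‖ ≤ 1 →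
    ∀ h : Rn n, ‖h‖ ≤ δ / 8 → ‖h‖ ≤ 1 →
    ‖∫ ξ : Rn n, F ξ * (Complex.exp (-((ε * (2 * Real.pi * ‖ξ‖) ^ 2 : ℝ) : ℂ)) *
        Complex.exp (2 * Real.pi * Complex.I * l * ((inner ℝ h ξ : ℝ) : ℂ)))‖ ≤ C * ‖F‖ := by
  obtain ⟨C1, hC1, hheat⟩ := exists_heat_bound (n := n) hδ
  -- The Gaussian rate `1/2` is that of `integral_Ioi_one_le`; the growth rate `1` is that of the
  -- complex phase when `|l|, |h| ≤ 1`.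
  obtain ⟨B, hB, hbd⟩ := exists_integral_norm_mul_exp_le (n := n) (by norm_num : (0 : ℝ) < 1 / 2) 1
  refine ⟨Real.exp 1 * C1 + 2 * B, by positivity,
    fun s hs0 hs1 F hF ε hε hε1 l hl h hh hh1 ↦ ?_⟩
  have hΓ := Real.Gamma_pos_of_pos hs0
  set P : Rn n → ℂ := fun ξ ↦ Complex.exp (2 * Real.pi * Complex.I * l * ((inner ℝ h ξ : ℝ) : ℂ))
    with hP
  have hPn : ∀ ξ, ‖P ξ‖ ≤ Real.exp (1 * (2 * Real.pi * ‖ξ‖)) := fun ξ ↦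
    (norm_cexp_complex_phase_le hl h ξ).trans (by gcongr; simpa using hh1)
  have hPc : Continuous P := by rw [hP]; fun_prop
  obtain ⟨Bε, hBε, hbε⟩ := exists_integral_norm_mul_exp_le (n := n) hε 1
  -- the integrand on the product space
  set Φ : Rn n → ℝ → ℂ := fun ξ t ↦ ((t ^ (s - 1) : ℝ) : ℂ) *
    ((((2 * Real.pi * ‖ξ‖) ^ (2 * s) : ℝ) : ℂ) *
      (F ξ * (Complex.exp (-(((t + ε) * (2 * Real.pi * ‖ξ‖) ^ 2 : ℝ) : ℂ)) * P ξ))) with hΦ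
  set Q : Rn n → ℂ := fun ξ ↦ F ξ * (Complex.exp (-((ε * (2 * Real.pi * ‖ξ‖) ^ 2 : ℝ) : ℂ)) * P ξ)
    with hQ
  have hQn : ∀ ξ, ‖Q ξ‖ ≤
      ‖F ξ‖ * Real.exp (1 * (2 * Real.pi * ‖ξ‖) - ε * (2 * Real.pi * ‖ξ‖) ^ 2) := by
    intro ξ
    rw [hQ, sub_eq_add_neg, Real.exp_add, norm_mul, norm_mul, norm_cexp_neg_ofReal,
      mul_comm (Real.exp (1 * _))]
    gcongr
    exact hPn ξ
  have hQm : AEStronglyMeasurable Q volume := by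
    refine (Lp.aestronglyMeasurable F).mul (Continuous.aestronglyMeasurable ?_)
    fun_prop
  have hQi : Integrable Q := (hbε F).1.mono' hQm (Filter.Eventually.of_forall hQn)
  have hΦQ : ∀ ξ t, Φ ξ t = (((2 * Real.pi * ‖ξ‖) ^ (2 * s) *
      (t ^ (s - 1) * Real.exp (-(t * (2 * Real.pi * ‖ξ‖) ^ 2))) : ℝ) : ℂ) * Q ξ := by
    intro ξ t
    have : Complex.exp (-(((t + ε) * (2 * Real.pi * ‖ξ‖) ^ 2 : ℝ) : ℂ)) =
        ((Real.exp (-(t * (2 * Real.pi * ‖ξ‖) ^ 2)) : ℝ) : ℂ) *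
          Complex.exp (-((ε * (2 * Real.pi * ‖ξ‖) ^ 2 : ℝ) : ℂ)) := by
      rw [Complex.ofReal_exp, ← Complex.exp_add]
      congr 1
      push_cast
      ring
    simp only [hΦ, hQ, this]
    push_cast
    ring
  have hne : ∀ᵐ ξ : Rn n, 0 < 2 * Real.pi * ‖ξ‖ := by
    have : Nonempty (Fin n) := ⟨⟨0, hn⟩⟩
    have h0 : ∀ᵐ ξ : Rn n, ξ ≠ 0 := by
      simp [ae_iff]
    filter_upwards [h0] with ξ hξ
    have := norm_pos_iff.2 hξ
    positivity
  -- the splitting `1 = I₁ + I₂`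
  set I1 : Rn n → ℝ := fun ξ ↦ (2 * Real.pi * ‖ξ‖) ^ (2 * s) *
    ∫ t in Ioc (0 : ℝ) 1, t ^ (s - 1) * Real.exp (-(t * (2 * Real.pi * ‖ξ‖) ^ 2)) with hI1
  set I2 : Rn n → ℝ := fun ξ ↦ (2 * Real.pi * ‖ξ‖) ^ (2 * s) *
    ∫ t in Ioi (1 : ℝ), t ^ (s - 1) * Real.exp (-(t * (2 * Real.pi * ‖ξ‖) ^ 2)) with hI2
  have hI1nn : ∀ ξ, 0 ≤ I1 ξ := fun ξ ↦ by
    refine mul_nonneg (by positivity) (setIntegral_nonneg measurableSet_Ioc fun t ht ↦ ?_)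
    have : 0 < t := ht.1
    positivity
  have hI2nn : ∀ ξ, 0 ≤ I2 ξ := fun ξ ↦ by
    refine mul_nonneg (by positivity) (setIntegral_nonneg measurableSet_Ioi fun t ht ↦ ?_)
    have : 0 < t := zero_lt_one.trans ht
    positivity
  have hI12 : ∀ᵐ ξ, I1 ξ + I2 ξ = Real.Gamma s := by
    filter_upwards [hne] with ξ hξ
    have hio := integrableOn_rpow_mul_exp hs0 (by positivity : 0 < (2 * Real.pi * ‖ξ‖) ^ 2)
    rw [← integral_rpow_mul_exp hs0 hξ, ← Ioc_union_Ioi_eq_Ioi (zero_le_one' ℝ),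
      setIntegral_union (Ioc_disjoint_Ioi le_rfl) measurableSet_Ioi
        (hio.mono_set Ioc_subset_Ioi_self) (hio.mono_set (Ioi_subset_Ioi zero_le_one)), mul_add]
  have hI1le : ∀ᵐ ξ, I1 ξ ≤ Real.Gamma s := by
    filter_upwards [hI12] with ξ hξ
    linarith [hI2nn ξ]
  have hΦm : AEStronglyMeasurable (Function.uncurry Φ)
      (volume.prod (volume.restrict (Ioc (0 : ℝ) 1))) := by
    have e : Function.uncurry Φ = fun p : Rn n × ℝ ↦ (((2 * Real.pi * ‖p.1‖) ^ (2 * s) *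
      (p.2 ^ (s - 1) * Real.exp (-(p.2 * (2 * Real.pi * ‖p.1‖) ^ 2))) : ℝ) : ℂ) * Q p.1 := by
      funext p
      exact hΦQ p.1 p.2
    rw [e]
    refine AEStronglyMeasurable.mul (Measurable.aestronglyMeasurable ?_) hQm.comp_fst
    fun_prop
  have hΦnorm : ∀ ξ, ∫ t in Ioc (0 : ℝ) 1, ‖Φ ξ t‖ = I1 ξ * ‖Q ξ‖ := by
    intro ξ
    simp only [hI1]
    rw [← integral_const_mul, ← integral_mul_const]
    refine setIntegral_congr_fun measurableSet_Ioc fun t ht ↦ ?_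
    have : 0 < t := ht.1
    change ‖Φ ξ t‖ = _
    rw [hΦQ, norm_mul, Complex.norm_real, Real.norm_of_nonneg (by positivity)]
  have hΦint : ∀ ξ, ∫ t in Ioc (0 : ℝ) 1, Φ ξ t = (I1 ξ : ℂ) * Q ξ := by
    intro ξ
    simp_rw [hΦQ]
    rw [integral_mul_const, integral_complex_ofReal, integral_const_mul]
  have hΦi : Integrable (Function.uncurry Φ) (volume.prod (volume.restrict (Ioc (0 : ℝ) 1))) := by
    rw [integrable_prod_iff hΦm]
    constructor
    · filter_upwards [hne] with ξ hξ
      have hio := (integrableOn_rpow_mul_exp hs0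
        (by positivity : 0 < (2 * Real.pi * ‖ξ‖) ^ 2)).mono_set Ioc_subset_Ioi_self (s := Ioc 0 1)
      have := ((hio.const_mul ((2 * Real.pi * ‖ξ‖) ^ (2 * s))).ofReal (𝕜 := ℂ)).mul_const (Q ξ)
      refine this.congr (Filter.Eventually.of_forall fun t ↦ ?_)
      exact (hΦQ ξ t).symm
    · simp only [Function.uncurry]
      refine (hQi.norm.const_mul (Real.Gamma s)).mono' hΦm.norm.integral_prod_right' ?_
      filter_upwards [hI1le] with ξ hξ
      rw [hΦnorm, Real.norm_of_nonneg (mul_nonneg (hI1nn ξ) (norm_nonneg _))]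
      gcongr
  have hA1i : Integrable fun ξ ↦ (I1 ξ : ℂ) * Q ξ := by
    have := hΦi.integral_prod_left
    simpa only [Function.uncurry, hΦint] using this
  have hA1 : ‖∫ ξ, (I1 ξ : ℂ) * Q ξ‖ ≤ Real.exp 1 * Real.Gamma s * (C1 * ‖F‖) := by
    simp_rw [← hΦint]
    -- After the exchange, the inner integral is the heat flow of `(-Δ)^s u` at time `t + ε`, to
    -- which the local bound applies.
    rw [integral_integral_swap hΦi]
    obtain ⟨k1, k2⟩ := integral_rpow_Ioc_le hs0
    have k3 : ∀ t ∈ Ioc (0 : ℝ) 1, ‖∫ ξ, Φ ξ t‖ ≤ t ^ (s - 1) * (C1 * ‖F‖) := by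
      intro t ht
      have ht0 : 0 < t := ht.1
      simp only [hΦ]
      rw [integral_const_mul, norm_mul, Complex.norm_real, Real.norm_of_nonneg (by positivity)]
      gcongr
      exact hheat s hs0 hs1 F hF (t + ε) (by positivity) (by linarith [ht.2]) l hl h hh hh1
    calc _ ≤ ∫ t in Ioc (0 : ℝ) 1, t ^ (s - 1) * (C1 * ‖F‖) :=
          norm_integral_le_of_norm_le (k1.mul_const _)
            ((ae_restrict_iff' measurableSet_Ioc).2 (Filter.Eventually.of_forall k3))
      _ = (∫ t in Ioc (0 : ℝ) 1, t ^ (s - 1)) * (C1 * ‖F‖) := integral_mul_const _ _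
      _ ≤ _ := by gcongr
  have hA2 : ‖∫ ξ, (I2 ξ : ℂ) * Q ξ‖ ≤ 2 * Real.Gamma s * (B * ‖F‖) := by
    obtain ⟨k1, k2⟩ := hbd F
    refine (norm_integral_le_of_norm_le (k1.const_mul (2 * Real.Gamma s)) ?_).trans ?_
    · filter_upwards [hne] with ξ hξ
      have k3 := integral_Ioi_one_le hs0 hs1 hξ
      have k4 : ‖Q ξ‖ ≤ ‖F ξ‖ * Real.exp (1 * (2 * Real.pi * ‖ξ‖)) := by
        refine (hQn ξ).trans ?_
        gcongr
        have : 0 ≤ ε * (2 * Real.pi * ‖ξ‖) ^ 2 := by positivity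
        linarith
      rw [norm_mul, Complex.norm_real, Real.norm_of_nonneg (hI2nn ξ), sub_eq_add_neg, Real.exp_add]
      calc _ ≤ (2 * Real.Gamma s * Real.exp (-(1 / 2 * (2 * Real.pi * ‖ξ‖) ^ 2))) *
            (‖F ξ‖ * Real.exp (1 * (2 * Real.pi * ‖ξ‖))) := by gcongr
        _ = _ := by ring
    · rw [integral_const_mul]
      gcongr
  have hsum : (Real.Gamma s : ℂ) * ∫ ξ, Q ξ = (∫ ξ, (I1 ξ : ℂ) * Q ξ) + ∫ ξ, (I2 ξ : ℂ) * Q ξ := by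
    have hA2i : Integrable fun ξ ↦ (I2 ξ : ℂ) * Q ξ := by
      refine ((hQi.const_mul (Real.Gamma s : ℂ)).sub hA1i).congr ?_
      filter_upwards [hI12] with ξ hξ
      simp only [Pi.sub_apply, ← hξ]
      push_cast
      ring
    rw [← integral_add hA1i hA2i, ← integral_const_mul]
    refine integral_congr_ae ?_
    filter_upwards [hI12] with ξ hξ
    simp only [← hξ]
    push_cast
    ring
  have hfin : Real.Gamma s * ‖∫ ξ, Q ξ‖ ≤ Real.Gamma s * ((Real.exp 1 * C1 + 2 * B) * ‖F‖) := by
    calc Real.Gamma s * ‖∫ ξ, Q ξ‖ = ‖(Real.Gamma s : ℂ) * ∫ ξ, Q ξ‖ := by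
          rw [norm_mul, Complex.norm_real, Real.norm_of_nonneg hΓ.le]
      _ ≤ Real.exp 1 * Real.Gamma s * (C1 * ‖F‖) + 2 * Real.Gamma s * (B * ‖F‖) := by
          rw [hsum]
          exact (norm_add_le _ _).trans (add_le_add hA1 hA2)
      _ = _ := by ring
  exact le_of_mul_le_mul_left hfin hΓ

/-! ### Power series from bounds in a complex neighbourhood -/

lemma card_filter_bijective (k : ℕ) [DecidablePred fun f : Fin k → Fin k ↦ Function.Bijective f] :
    (Finset.univ.filter fun f : Fin k → Fin k ↦ Function.Bijective f).card = k.factorial := by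
  classical
  have h : (Finset.univ.filter fun f : Fin k → Fin k ↦ Function.Bijective f) =
      Finset.univ.image fun σ : Equiv.Perm (Fin k) ↦ (σ : Fin k → Fin k) := by
    ext f
    simp only [Finset.mem_filter, Finset.mem_univ, true_and, Finset.mem_image]
    exact ⟨fun hf ↦ ⟨Equiv.ofBijective f hf, rfl⟩, fun ⟨σ, hσ⟩ ↦ hσ ▸ σ.bijective⟩
  rw [h, Finset.card_image_of_injective _ DFunLike.coe_injective, Finset.card_univ,
    Fintype.card_perm, Fintype.card_fin]

/-- The polarization identity for a product. -/
lemma factorial_mul_prod_eq (k : ℕ) (x : Fin k → ℝ) :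
    (k.factorial : ℝ) * ∏ i, x i = (-1) ^ k *
      ∑ S : Finset (Fin k), (-1) ^ S.card * (∑ i ∈ S, x i) ^ k := by
  classical
  -- The condition that `f` take values in `S` is written as a product over `Sᶜ`, so that the
  -- alternating sum over `S` factors over indices. The factor at `i` is `-1` if `f` hits `i` and
  -- `0` otherwise; only bijections survive.
  have h1 : ∀ S : Finset (Fin k), (∑ i ∈ S, x i) ^ k =
      ∑ f : Fin k → Fin k, (∏ i ∈ Sᶜ, if i ∈ Set.range f then (0 : ℝ) else 1) * ∏ j, x (f j) := by
    intro S
    have e := Finset.prod_univ_sum (fun _ : Fin k ↦ S) (fun _ i ↦ x i)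
    rw [Finset.prod_const, Finset.card_univ, Fintype.card_fin] at e
    rw [e, ← Finset.sum_filter_add_sum_filter_not Finset.univ
      (fun f : Fin k → Fin k ↦ f ∈ Fintype.piFinset fun _ : Fin k ↦ S)]
    have e2 : ∑ f ∈ Finset.univ.filter
        (fun f : Fin k → Fin k ↦ ¬ f ∈ Fintype.piFinset fun _ : Fin k ↦ S),
        (∏ i ∈ Sᶜ, if i ∈ Set.range f then (0 : ℝ) else 1) * ∏ j, x (f j) = 0 := by
      refine Finset.sum_eq_zero fun f hf ↦ ?_
      simp only [Fintype.mem_piFinset, Finset.mem_filter, Finset.mem_univ, true_and,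
        not_forall] at hf
      obtain ⟨j, hj⟩ := hf
      rw [Finset.prod_eq_zero (i := f j) (by simpa using hj) (by simp), zero_mul]
    rw [e2, add_zero]
    refine Finset.sum_congr (by ext; simp) fun f hf ↦ ?_
    replace hf := Fintype.mem_piFinset.1 (Finset.mem_filter.1 hf).2
    have e3 : (∏ i ∈ Sᶜ, if i ∈ Set.range f then (0 : ℝ) else 1) = 1 := by
      refine Finset.prod_eq_one fun i hi ↦ if_neg ?_
      rintro ⟨j, rfl⟩
      exact (Finset.mem_compl.1 hi) (hf j)
    rw [e3, one_mul]
  simp_rw [h1, Finset.mul_sum]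
  rw [Finset.sum_comm]
  have h2 : ∀ f : Fin k → Fin k, ∑ S : Finset (Fin k), (-1 : ℝ) ^ k * ((-1) ^ S.card *
      ((∏ i ∈ Sᶜ, if i ∈ Set.range f then (0 : ℝ) else 1) * ∏ j, x (f j))) =
      if Function.Bijective f then ∏ j, x j else 0 := by
    intro f
    have e : ∑ S : Finset (Fin k), (-1 : ℝ) ^ k * ((-1) ^ S.card *
      ((∏ i ∈ Sᶜ, if i ∈ Set.range f then (0 : ℝ) else 1) * ∏ j, x (f j))) =
        (-1 : ℝ) ^ k * (∏ j, x (f j)) *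
          ∏ i : Fin k, ((-1 : ℝ) + if i ∈ Set.range f then (0 : ℝ) else 1) := by
      rw [Finset.prod_add, Finset.powerset_univ, Finset.mul_sum]
      refine Finset.sum_congr rfl fun S _ ↦ ?_
      rw [Finset.prod_const, Finset.compl_eq_univ_sdiff]
      ring
    rw [e]
    split_ifs with hf
    · have : ∀ i : Fin k, i ∈ Set.range f := fun i ↦ hf.2 i
      simp only [this, if_true, add_zero, Finset.prod_const, Finset.card_univ, Fintype.card_fin]
      rw [mul_right_comm, ← mul_pow, (hf.prod_comp x)]
      norm_num
    · have hns : ¬ Function.Surjective f := fun h ↦ hf (Finite.surjective_iff_bijective.1 h)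
      simp only [Function.Surjective, not_forall] at hns
      obtain ⟨i, hi⟩ := hns
      have hz : ∏ i : Fin k, ((-1 : ℝ) + if i ∈ Set.range f then (0 : ℝ) else 1) = 0 :=
        Finset.prod_eq_zero (Finset.mem_univ i) (by rw [if_neg (by simpa using hi)]; norm_num)
      rw [hz, mul_zero]
  rw [Finset.sum_congr rfl fun f _ ↦ h2 f, ← Finset.sum_filter, Finset.sum_const,
    card_filter_bijective, nsmul_eq_mul]

/-- Cauchy's estimate for an everywhere convergent power series. -/
lemma norm_coeff_le_of_hasSum {a : ℕ → ℂ} {f : ℂ → ℂ} {C : ℝ}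
    (h : ∀ z, HasSum (fun k ↦ z ^ k * a k) (f z)) (hC : ∀ z, ‖z‖ ≤ 1 → ‖f z‖ ≤ C) (k : ℕ) :
    ‖a k‖ ≤ C := by
  set p : FormalMultilinearSeries ℂ ℂ ℂ := FormalMultilinearSeries.ofScalars ℂ a with hp
  have hpk : ∀ k, ‖p k‖ = ‖a k‖ := fun k ↦ FormalMultilinearSeries.ofScalars_norm ℂ a k
  have hball : HasFPowerSeriesOnBall f p 0 2 := by
    -- Any radius above `1` would do: the Cauchy estimate is taken on the unit circle.
    refine ⟨?_, by norm_num, fun {y} _ ↦ ?_⟩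
    · have hs := (h 2).summable.norm
      have := p.le_radius_of_summable (r := 2) (by
        refine hs.congr fun k ↦ ?_
        rw [hpk, norm_mul, norm_pow]
        simp [mul_comm])
      exact_mod_cast this
    · rw [zero_add]
      refine (h y).congr_fun fun k ↦ ?_
      simp [hp, FormalMultilinearSeries.ofScalars, mul_comm]
  have hdiff : DiffContOnCl ℂ f (Metric.ball 0 1) := by
    refine hball.differentiableOn.diffContOnCl_ball fun z hz ↦ ?_
    have hz1 : dist z 0 ≤ 1 := hz
    rw [Metric.mem_eball, edist_dist]
    exact (ENNReal.ofReal_le_one.2 hz1).trans_lt (by norm_num)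
  have h1 := Complex.norm_iteratedDeriv_le_of_forall_mem_sphere_norm_le k one_pos hdiff
    (C := C) fun z hz ↦ hC z (by simpa using (mem_sphere_iff_norm.1 hz).le)
  have h2 := hball.factorial_smul 1 k
  rw [iteratedDeriv_eq_iteratedFDeriv, ← h2] at h1
  have h3 : p k (fun _ ↦ (1 : ℂ)) = a k := by simp [hp, FormalMultilinearSeries.ofScalars]
  rw [h3, one_pow, div_one, nsmul_eq_mul, norm_mul, Complex.norm_natCast] at h1
  exact le_of_mul_le_mul_left h1 (by positivity)

/-- The integrands of the Taylor coefficients of `h ↦ ∫ G(ξ) exp (2πi ⟨h, ξ⟩) dξ`. -/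
def taylorIntegrand (G : Rn n → ℂ) (k : ℕ) (ξ : Rn n) :
    ContinuousMultilinearMap ℝ (fun _ : Fin k ↦ Rn n) ℂ :=
  VectorFourier.fourierPowSMulRight (-innerSL ℝ : Rn n →L[ℝ] Rn n →L[ℝ] ℝ) G ξ k

lemma taylorIntegrand_apply (G : Rn n → ℂ) (k : ℕ) (ξ : Rn n) (m : Fin k → Rn n) :
    taylorIntegrand G k ξ m =
      (2 * Real.pi * Complex.I) ^ k * ((∏ i, inner ℝ (m i) ξ : ℝ) : ℂ) * G ξ := by
  have e : ∏ i, (-innerSL ℝ : Rn n →L[ℝ] Rn n →L[ℝ] ℝ) ξ (m i) =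
      (-1) ^ k * ∏ i, inner ℝ (m i) ξ := by
    simp only [_root_.neg_apply, innerSL_apply_apply, Finset.prod_neg, Finset.card_univ, Fintype.card_fin,
      real_inner_comm]
  rw [taylorIntegrand, VectorFourier.fourierPowSMulRight_apply, e, Complex.real_smul, smul_eq_mul,
    neg_pow]
  push_cast
  have : ((-1 : ℂ) ^ k) * (-1) ^ k = 1 := by rw [← mul_pow]; norm_num
  linear_combination ((2 * Real.pi * Complex.I) ^ k * (∏ i, (inner ℝ (m i) ξ : ℂ)) * G ξ) * this

/-- The Taylor series of `h ↦ ∫ G(ξ) exp (2πi ⟨h, ξ⟩) dξ` at the origin. -/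
def taylorSeries (G : Rn n → ℂ) : FormalMultilinearSeries ℝ (Rn n) ℂ :=
  fun k ↦ ((k.factorial : ℝ)⁻¹) • ∫ ξ, taylorIntegrand G k ξ

lemma integrable_taylorIntegrand {G : Rn n → ℂ} (hGm : AEStronglyMeasurable G volume)
    (hG : ∀ M : ℝ, Integrable fun ξ ↦ ‖G ξ‖ * Real.exp (M * (2 * Real.pi * ‖ξ‖))) (k : ℕ) :
    Integrable (taylorIntegrand G k) := by
  refine VectorFourier.integrable_fourierPowSMulRight _ ?_ hGm
  refine ((hG 1).const_mul (k.factorial : ℝ)).mono' ?_ (Filter.Eventually.of_forall fun ξ ↦ ?_)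
  · exact (continuous_norm.pow k).aestronglyMeasurable.mul hGm.norm
  · rw [Real.norm_of_nonneg (by positivity)]
    have h1 := Real.pow_div_factorial_le_exp (2 * Real.pi * ‖ξ‖) (by positivity) k
    rw [div_le_iff₀' (by positivity)] at h1
    have h2 : ‖ξ‖ ^ k ≤ (2 * Real.pi * ‖ξ‖) ^ k := by
      gcongr
      nlinarith [Real.pi_gt_three, norm_nonneg ξ]
    rw [one_mul]
    calc ‖ξ‖ ^ k * ‖G ξ‖ ≤ (k.factorial * Real.exp (2 * Real.pi * ‖ξ‖)) * ‖G ξ‖ := by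
          gcongr; exact h2.trans h1
      _ = _ := by ring

lemma taylorSeries_apply {G : Rn n → ℂ} {k : ℕ} (hi : Integrable (taylorIntegrand G k))
    (m : Fin k → Rn n) :
    taylorSeries G k m = ((k.factorial : ℝ)⁻¹ : ℂ) * ∫ ξ, taylorIntegrand G k ξ m := by
  have := (ContinuousMultilinearMap.apply ℝ (fun _ : Fin k ↦ Rn n) ℂ m).integral_comp_comm hi
  simp only [ContinuousMultilinearMap.apply_apply] at this
  rw [this, taylorSeries, _root_.smul_apply, Complex.real_smul]
  push_cast
  rfl

lemma hasSum_taylorSeries {G : Rn n → ℂ} (hGm : AEStronglyMeasurable G volume)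
    (hG : ∀ M : ℝ, Integrable fun ξ ↦ ‖G ξ‖ * Real.exp (M * (2 * Real.pi * ‖ξ‖))) (l : ℂ)
    (h : Rn n) :
    HasSum (fun k ↦ l ^ k * taylorSeries G k (fun _ ↦ h))
      (∫ ξ, G ξ * Complex.exp (2 * Real.pi * Complex.I * l * ((inner ℝ h ξ : ℝ) : ℂ))) := by
  have hterm : ∀ k, l ^ k * taylorSeries G k (fun _ ↦ h) = ∫ ξ, G ξ *
      ((2 * Real.pi * Complex.I * l * ((inner ℝ h ξ : ℝ) : ℂ)) ^ k / k.factorial) := by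
    intro k
    rw [taylorSeries_apply (integrable_taylorIntegrand hGm hG k), ← integral_const_mul,
      ← integral_const_mul]
    congr 1
    funext ξ
    rw [taylorIntegrand_apply, Finset.prod_const, Finset.card_univ, Fintype.card_fin]
    push_cast
    ring
  simp_rw [hterm]
  have hnorm : ∀ ξ : Rn n, ‖2 * Real.pi * Complex.I * l * ((inner ℝ h ξ : ℝ) : ℂ)‖ ≤
      ‖l‖ * ‖h‖ * (2 * Real.pi * ‖ξ‖) := by
    intro ξ
    simp only [norm_mul, Complex.norm_ofNat, Complex.norm_real, Complex.norm_I, mul_one,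
      Real.norm_of_nonneg Real.pi_pos.le]
    calc 2 * Real.pi * ‖l‖ * ‖inner ℝ h ξ‖ ≤ 2 * Real.pi * ‖l‖ * (‖h‖ * ‖ξ‖) := by
          gcongr; exact abs_real_inner_le_norm h ξ
      _ = _ := by ring
  have hexp : ∀ x : ℝ, HasSum (fun k : ℕ ↦ x ^ k / k.factorial) (Real.exp x) := fun x ↦ by
    rw [Real.exp_eq_exp_ℝ]; exact NormedSpace.expSeries_div_hasSum_exp x
  have hcexp : ∀ x : ℂ, HasSum (fun k : ℕ ↦ x ^ k / k.factorial) (Complex.exp x) := fun x ↦ by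
    rw [Complex.exp_eq_exp_ℂ]; exact NormedSpace.expSeries_div_hasSum_exp x
  have hb : ∀ ξ : Rn n, HasSum (fun k : ℕ ↦ ‖G ξ‖ *
      ((‖l‖ * ‖h‖ * (2 * Real.pi * ‖ξ‖)) ^ k / k.factorial))
      (‖G ξ‖ * Real.exp (‖l‖ * ‖h‖ * (2 * Real.pi * ‖ξ‖))) := fun ξ ↦ (hexp _).mul_left _
  refine hasSum_integral_of_dominated_convergence (fun k ξ ↦ ‖G ξ‖ *
      ((‖l‖ * ‖h‖ * (2 * Real.pi * ‖ξ‖)) ^ k / k.factorial)) (fun k ↦ ?_) (fun k ↦ ?_) ?_ ?_ ?_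
  · refine hGm.mul (Continuous.aestronglyMeasurable ?_)
    fun_prop
  · refine Filter.Eventually.of_forall fun ξ ↦ ?_
    rw [norm_mul, norm_div, norm_pow, Complex.norm_natCast]
    gcongr
    exact hnorm ξ
  · exact Filter.Eventually.of_forall fun ξ ↦ (hb ξ).summable
  · refine (hG (‖l‖ * ‖h‖)).congr (Filter.Eventually.of_forall fun ξ ↦ ?_)
    exact (hb ξ).tsum_eq.symm
  · exact Filter.Eventually.of_forall fun ξ ↦ (hcexp _).mul_left _

/-- Cauchy's estimate in the complex variable `l` bounds the diagonal values of each coefficient;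
the polarization identity then bounds all its values, and `(k+1)^k / k! ≤ e^{k+1}` keeps the loss
geometric. -/
lemma norm_taylorSeries_le {G : Rn n → ℂ} (hGm : AEStronglyMeasurable G volume)
    (hG : ∀ M : ℝ, Integrable fun ξ ↦ ‖G ξ‖ * Real.exp (M * (2 * Real.pi * ‖ξ‖))) {ρ C : ℝ}
    (hρ : 0 < ρ) (hC : ∀ l : ℂ, ‖l‖ ≤ 1 → ∀ h : Rn n, ‖h‖ ≤ ρ →
      ‖∫ ξ, G ξ * Complex.exp (2 * Real.pi * Complex.I * l * ((inner ℝ h ξ : ℝ) : ℂ))‖ ≤ C)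
    (k : ℕ) : ‖taylorSeries G k‖ ≤ Real.exp 1 * C * (2 * Real.exp 1 / ρ) ^ k := by
  have hC0 : 0 ≤ C := (norm_nonneg _).trans (hC 0 (by simp) 0 (by simpa using hρ.le))
  have hi := integrable_taylorIntegrand hGm hG k
  have hdiag : ∀ v : Rn n, ‖v‖ ≤ ρ → ‖taylorSeries G k (fun _ ↦ v)‖ ≤ C := fun v hv ↦
    norm_coeff_le_of_hasSum (a := fun k ↦ taylorSeries G k (fun _ ↦ v))
      (fun z ↦ hasSum_taylorSeries hGm hG z v) (fun z hz ↦ hC z hz v hv) k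
  -- Polarization evaluates at sums of at most `k` unit vectors, of norm at most `k`; `k + 1` avoids
  -- dividing by zero when `k = 0`.
  have hdiag' : ∀ v : Rn n, ‖v‖ ≤ k + 1 →
      ‖taylorSeries G k (fun _ ↦ v)‖ ≤ ((k + 1) / ρ) ^ k * C := by
    intro v hv
    have hr : (0 : ℝ) < (k + 1) / ρ := by positivity
    have e : (fun _ : Fin k ↦ v) = fun _ ↦ (((k : ℝ) + 1) / ρ) • ((((k : ℝ) + 1) / ρ)⁻¹ • v) := by
      funext _
      rw [smul_smul, mul_inv_cancel₀ hr.ne', one_smul]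
    rw [e, ContinuousMultilinearMap.map_smul_univ, Finset.prod_const, Finset.card_univ,
      Fintype.card_fin, norm_smul, Real.norm_of_nonneg (by positivity)]
    gcongr
    refine hdiag _ ?_
    rw [norm_smul, Real.norm_of_nonneg (by positivity), inv_div, div_mul_eq_mul_div,
      div_le_iff₀ (by positivity)]
    gcongr
  have hpol : ∀ m : Fin k → Rn n, (k.factorial : ℂ) * taylorSeries G k m = (-1) ^ k *
      ∑ S : Finset (Fin k), (-1) ^ S.card * taylorSeries G k (fun _ ↦ ∑ i ∈ S, m i) := by
    intro m
    have hia : ∀ m : Fin k → Rn n, Integrable fun ξ ↦ taylorIntegrand G k ξ m := fun m ↦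
      (ContinuousMultilinearMap.apply ℝ (fun _ : Fin k ↦ Rn n) ℂ m).integrable_comp hi
    have hT : (k.factorial : ℂ) * ∫ ξ, taylorIntegrand G k ξ m = (-1) ^ k *
        ∑ S : Finset (Fin k), (-1) ^ S.card * ∫ ξ, taylorIntegrand G k ξ fun _ ↦ ∑ i ∈ S, m i := by
      simp_rw [← integral_const_mul]
      rw [← integral_finsetSum _ (fun S _ ↦ (hia _).const_mul _), ← integral_const_mul]
      congr 1
      funext ξ
      simp_rw [taylorIntegrand_apply]
      have hp := congrArg (fun r : ℝ ↦ (r : ℂ)) (factorial_mul_prod_eq k fun i ↦ inner ℝ (m i) ξ)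
      simp only [Finset.prod_const, Finset.card_univ, Fintype.card_fin, sum_inner]
      push_cast at hp ⊢
      calc _ = (2 * Real.pi * Complex.I) ^ k * G ξ *
            ((k.factorial : ℂ) * ∏ i, ((inner ℝ (m i) ξ : ℝ) : ℂ)) := by ring
        _ = _ := by
            rw [hp, Finset.mul_sum, Finset.mul_sum, Finset.mul_sum]
            refine Finset.sum_congr rfl fun S _ ↦ ?_
            ring
    simp_rw [taylorSeries_apply hi]
    rw [mul_left_comm, hT, mul_left_comm, Finset.mul_sum]
    congr 1
    exact Finset.sum_congr rfl fun S _ ↦ by ring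
  have hunit : ∀ m : Fin k → Rn n, (∀ i, ‖m i‖ ≤ 1) →
      ‖taylorSeries G k m‖ ≤ Real.exp 1 * C * (2 * Real.exp 1 / ρ) ^ k := by
    intro m hm
    have h1 : (k.factorial : ℝ) * ‖taylorSeries G k m‖ ≤ 2 ^ k * (((k + 1) / ρ) ^ k * C) := by
      calc (k.factorial : ℝ) * ‖taylorSeries G k m‖
          = ‖(k.factorial : ℂ) * taylorSeries G k m‖ := by rw [norm_mul, Complex.norm_natCast]
        _ ≤ ∑ S : Finset (Fin k), ((k + 1) / ρ) ^ k * C := by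
            rw [hpol, norm_mul, norm_pow, norm_neg, norm_one, one_pow, one_mul]
            refine (norm_sum_le _ _).trans (Finset.sum_le_sum fun S _ ↦ ?_)
            rw [norm_mul, norm_pow, norm_neg, norm_one, one_pow, one_mul]
            refine hdiag' _ ((norm_sum_le _ _).trans ?_)
            calc ∑ i ∈ S, ‖m i‖ ≤ ∑ _i ∈ S, (1 : ℝ) := Finset.sum_le_sum fun i _ ↦ hm i
              _ ≤ k + 1 := by
                have := Finset.card_le_univ S
                rw [Fintype.card_fin] at this
                have : (S.card : ℝ) ≤ k := by exact_mod_cast this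
                simp; linarith
        _ = _ := by simp
    have h2 := Real.pow_div_factorial_le_exp ((k : ℝ) + 1) (by positivity) k
    rw [div_le_iff₀' (by positivity)] at h2
    refine le_of_mul_le_mul_left (h1.trans ?_) (by positivity : (0 : ℝ) < k.factorial)
    have h3 : Real.exp ((k : ℝ) + 1) = Real.exp 1 ^ k * Real.exp 1 := by
      rw [Real.exp_add, ← Real.exp_nat_mul, mul_one]
    rw [div_pow, div_pow, mul_pow]
    calc 2 ^ k * (((k : ℝ) + 1) ^ k / ρ ^ k * C)
        ≤ 2 ^ k * ((k.factorial * Real.exp ((k : ℝ) + 1)) / ρ ^ k * C) := by gcongr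
      _ = _ := by rw [h3]; ring
  refine ContinuousMultilinearMap.opNorm_le_bound (by positivity) fun m ↦ ?_
  have e : m = fun i ↦ ‖m i‖ • (‖m i‖⁻¹ • m i) := by
    funext i
    rcases eq_or_ne (m i) 0 with h | h
    · simp [h]
    · rw [smul_smul, mul_inv_cancel₀ (norm_ne_zero_iff.2 h), one_smul]
  conv_lhs => rw [e]
  rw [ContinuousMultilinearMap.map_smul_univ, norm_smul, Real.norm_of_nonneg
    (Finset.prod_nonneg fun i _ ↦ norm_nonneg _), mul_comm]
  gcongr
  refine hunit _ fun i ↦ ?_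
  rw [norm_smul, norm_inv, norm_norm]
  exact inv_mul_le_one

/-! ### Local analyticity -/

lemma finiteDimensional_multilinear (k : ℕ) :
    FiniteDimensional ℝ (ContinuousMultilinearMap ℝ (fun _ : Fin k ↦ Rn n) ℂ) :=
  Module.Finite.of_injective
    ({ toFun := fun f ↦ f.toMultilinearMap
       map_add' := fun _ _ ↦ rfl
       map_smul' := fun _ _ ↦ rfl } :
      ContinuousMultilinearMap ℝ (fun _ : Fin k ↦ Rn n) ℂ →ₗ[ℝ]
        MultilinearMap ℝ (fun _ : Fin k ↦ Rn n) ℂ)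
    ContinuousMultilinearMap.toMultilinearMap_injective

/-- Pointwise limits of functions with uniformly bounded Taylor coefficients are analytic. -/
lemma exists_analytic_limit {U : ℕ → Rn n → ℂ} {q : ℕ → FormalMultilinearSeries ℝ (Rn n) ℂ}
    {C R r : ℝ} (hR : 0 < R) (hr : 0 < r) (hRr : R * r < 1) (x₀ : Rn n)
    (hq : ∀ i k, ‖q i k‖ ≤ C * R ^ k)
    (hU : ∀ i h, HasSum (fun k ↦ q i k (fun _ ↦ h)) (U i (x₀ + h))) :
    ∃ (g : Rn n → ℂ) (p : FormalMultilinearSeries ℝ (Rn n) ℂ),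
      HasFPowerSeriesOnBall g p x₀ (ENNReal.ofReal r) ∧ (∀ k, ‖p k‖ ≤ C * R ^ k) ∧
      ∀ x ∈ Metric.ball x₀ r, ∀ v, Filter.Tendsto (fun i ↦ U i x) Filter.atTop (nhds v) →
        v = g x := by
  -- Closed balls in these finite-dimensional spaces are compact, and one ultrafilter serves all `k`
  -- at once, replacing a diagonal subsequence.
  have hlim : ∀ k, ∃ L : ContinuousMultilinearMap ℝ (fun _ : Fin k ↦ Rn n) ℂ,
      ‖L‖ ≤ C * R ^ k ∧ Filter.Tendsto (fun i ↦ q i k) (Filter.hyperfilter ℕ) (nhds L) := by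
    intro k
    have := finiteDimensional_multilinear (n := n) k
    have : ProperSpace (ContinuousMultilinearMap ℝ (fun _ : Fin k ↦ Rn n) ℂ) :=
      FiniteDimensional.proper ℝ _
    obtain ⟨L, hL, hle⟩ := (isCompact_closedBall
      (0 : ContinuousMultilinearMap ℝ (fun _ : Fin k ↦ Rn n) ℂ) (C * R ^ k)).ultrafilter_le_nhds
      ((Filter.hyperfilter ℕ).map fun i ↦ q i k) (by
        rw [Filter.le_principal_iff]
        exact Filter.mem_map.2 (Filter.Eventually.of_forall fun i ↦ by simpa using hq i k))
    exact ⟨L, by simpa using hL, hle⟩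
  choose L hL hLt using hlim
  let p : FormalMultilinearSeries ℝ (Rn n) ℂ := L
  have hgeo : ∀ {ρ : ℝ}, 0 ≤ ρ → R * ρ < 1 → Summable fun k ↦ C * (R * ρ) ^ k := fun hρ h ↦
    (summable_geometric_of_lt_one (by positivity) h).mul_left C
  have hrad : ENNReal.ofReal r ≤ p.radius := by
    refine p.le_radius_of_summable (r := r.toNNReal) ?_
    refine Summable.of_nonneg_of_le (fun k ↦ by positivity) (fun k ↦ ?_) (hgeo hr.le hRr)
    rw [Real.coe_toNNReal _ hr.le, mul_pow, ← mul_assoc]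
    gcongr
    exact hL k
  have hps : HasFPowerSeriesOnBall (fun x ↦ p.sum (x - x₀)) p x₀ (ENNReal.ofReal r) := by
    have hpos : 0 < ENNReal.ofReal r := ENNReal.ofReal_pos.2 hr
    have := (p.hasFPowerSeriesOnBall (hpos.trans_le hrad)).comp_sub x₀
    rw [zero_add] at this
    exact this.mono hpos hrad
  refine ⟨fun x ↦ p.sum (x - x₀), p, hps, hL, fun x hx v hv ↦ ?_⟩
  set h := x - x₀ with hh
  have hhr : ‖h‖ < r := by rwa [mem_ball_iff_norm] at hx
  have hxh : x = x₀ + h := by rw [hh]; abel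
  have hb : ∀ (T : FormalMultilinearSeries ℝ (Rn n) ℂ), (∀ k, ‖T k‖ ≤ C * R ^ k) → ∀ k,
      ‖T k (fun _ ↦ h)‖ ≤ C * (R * ‖h‖) ^ k := by
    intro T hT k
    refine ((T k).le_opNorm _).trans ?_
    rw [Finset.prod_const, Finset.card_univ, Fintype.card_fin, mul_pow, ← mul_assoc]
    gcongr
    exact hT k
  have hRh : R * ‖h‖ < 1 := lt_of_le_of_lt (by gcongr) hRr
  have h1 : Filter.Tendsto (fun i ↦ ∑' k, q i k (fun _ ↦ h)) (Filter.hyperfilter ℕ)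
      (nhds (∑' k, p k (fun _ ↦ h))) := by
    refine tendsto_tsum_of_dominated_convergence (hgeo (norm_nonneg h) hRh) (fun k ↦ ?_)
      (Filter.Eventually.of_forall fun i k ↦ hb (q i) (hq i) k)
    exact ((ContinuousMultilinearMap.apply ℝ (fun _ : Fin k ↦ Rn n) ℂ
      (fun _ ↦ h)).continuous.tendsto _).comp (hLt k)
  have h2 : (fun i ↦ ∑' k, q i k (fun _ ↦ h)) = fun i ↦ U i x := by
    funext i
    rw [(hU i h).tsum_eq, hxh]
  rw [h2] at h1
  have h3 := hv.mono_left (Filter.hyperfilter_le_cofinite.trans Nat.cofinite_eq_atTop.le)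
  exact tendsto_nhds_unique h3 h1

/-- Frequency-side translation of `u` by `x₀`. -/
lemma exists_translated (u : L2 n) (x₀ : Rn n) : ∃ F : L2 n, ‖F‖ = ‖u‖ ∧
    (F : Rn n → ℂ) =ᵐ[volume] fun ξ ↦
      (𝓕 u : L2 n) ξ * Complex.exp (2 * Real.pi * Complex.I * ((inner ℝ x₀ ξ : ℝ) : ℂ)) := by
  have hn : ∀ ξ : Rn n,
      ‖Complex.exp (2 * Real.pi * Complex.I * ((inner ℝ x₀ ξ : ℝ) : ℂ))‖ = 1 := by
    intro ξ
    rw [Complex.norm_exp]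
    simp
  have hm : MemLp (fun ξ ↦ (𝓕 u : L2 n) ξ *
      Complex.exp (2 * Real.pi * Complex.I * ((inner ℝ x₀ ξ : ℝ) : ℂ))) 2 volume := by
    refine (Lp.memLp (𝓕 u : L2 n)).of_le ?_ (Filter.Eventually.of_forall fun ξ ↦ ?_)
    · refine (Lp.aestronglyMeasurable _).mul (Continuous.aestronglyMeasurable ?_)
      fun_prop
    · rw [norm_mul, hn, mul_one]
  refine ⟨hm.toLp _, ?_, hm.coeFn_toLp⟩
  rw [← Lp.norm_fourier_eq u, Lp.norm_toLp, Lp.norm_def]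
  congr 1
  refine eLpNorm_congr_norm_ae (Filter.Eventually.of_forall fun ξ ↦ ?_)
  rw [norm_mul, hn, mul_one]

lemma fourier_translate {φ ψ : 𝓢(Rn n, ℂ)} {x₀ : Rn n} (h : ∀ y, ψ y = φ (y - x₀)) (ξ : Rn n) :
    𝓕 ψ ξ = Complex.exp (-(2 * Real.pi * Complex.I * ((inner ℝ x₀ ξ : ℝ) : ℂ))) * 𝓕 φ ξ := by
  have h1 : (ψ : Rn n → ℂ) = φ ∘ fun v ↦ v + (-x₀) := by
    funext y
    simp [h, sub_eq_add_neg]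
  have h2 := congrFun (VectorFourier.fourierIntegral_comp_add_right Real.fourierChar
    (volume : Measure (Rn n)) (innerₗ (Rn n)) φ (-x₀)) ξ
  rw [SchwartzMap.fourier_coe, SchwartzMap.fourier_coe, h1]
  refine h2.trans ?_
  rw [Circle.smul_def, smul_eq_mul, Real.fourierChar_apply]
  congr 2
  simp only [innerₗ_apply_apply, inner_neg_left]
  push_cast
  ring

lemma fracHarmonicNearZero_translated {s δ : ℝ} {u F : L2 n} {x₀ : Rn n}
    (hF : (F : Rn n → ℂ) =ᵐ[volume] fun ξ ↦
      (𝓕 u : L2 n) ξ * Complex.exp (2 * Real.pi * Complex.I * ((inner ℝ x₀ ξ : ℝ) : ℂ)))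
    (hu : ∀ φ : 𝓢(Rn n, ℂ), HasCompactSupport φ → tsupport φ ⊆ Metric.ball x₀ δ →
      fracLaplacePairing s u (φ.toLp 2 (volume : Measure (Rn n))) = 0) :
    FracHarmonicNearZero s δ F := by
  intro φ hφc hφs
  let τ : Rn n ≃ₜ Rn n := Homeomorph.subRight x₀
  have hcs : HasCompactSupport (φ ∘ τ) := hφc.comp_homeomorph τ
  have hsm : ContDiff ℝ ∞ (φ ∘ τ) := φ.smooth'.comp (contDiff_id.sub contDiff_const)
  let ψ : 𝓢(Rn n, ℂ) := hcs.toSchwartzMap hsm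
  have hψ : ∀ y, ψ y = φ (y - x₀) := fun y ↦ by simp [ψ, τ]
  have hψ' : (ψ : Rn n → ℂ) = φ ∘ τ := funext hψ
  have hsupp : tsupport ψ ⊆ Metric.ball x₀ δ := by
    rw [hψ', tsupport_comp_eq_preimage]
    intro y hy
    have := hφs hy
    simpa [τ, dist_eq_norm] using this
  have h0 := hu ψ (by rw [hψ']; exact hcs) hsupp
  rw [fracLaplacePairing, SchwartzMap.toLp_fourier_eq] at h0
  rw [← h0]
  refine integral_congr_ae ?_
  filter_upwards [hF, (𝓕 ψ).coeFn_toLp 2 (volume : Measure (Rn n))] with ξ h1 h2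
  rw [h1, h2, fourier_translate hψ, map_mul, ← Complex.exp_conj]
  have e3 : starRingEnd ℂ 2 = 2 := map_ofNat _ 2
  have e4 : starRingEnd ℂ (-(2 * Real.pi * Complex.I * ((inner ℝ x₀ ξ : ℝ) : ℂ))) =
      2 * Real.pi * Complex.I * ((inner ℝ x₀ ξ : ℝ) : ℂ) := by
    simp [e3]
  rw [e4]
  ring

/-- Gaussian mollification on the Fourier side. -/
lemma exists_mollified_seq (u : L2 n) : ∃ H : ℕ → L2 n,
    (∀ j, (H j : Rn n → ℂ) =ᵐ[volume] fun ξ ↦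
      Complex.exp (-((1 / ((j : ℝ) + 1) * (2 * Real.pi * ‖ξ‖) ^ 2 : ℝ) : ℂ)) * (𝓕 u : L2 n) ξ) ∧
    Filter.Tendsto H Filter.atTop (nhds (𝓕 u)) := by
  have hb : ∀ (j : ℕ) (ξ : Rn n),
      ‖Complex.exp (-((1 / ((j : ℝ) + 1) * (2 * Real.pi * ‖ξ‖) ^ 2 : ℝ) : ℂ))‖ ≤ 1 := by
    intro j ξ
    rw [norm_cexp_neg_ofReal, Real.exp_le_one_iff, Left.neg_nonpos_iff]
    positivity
  have hm : ∀ j : ℕ, MemLp (fun ξ : Rn n ↦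
      Complex.exp (-((1 / ((j : ℝ) + 1) * (2 * Real.pi * ‖ξ‖) ^ 2 : ℝ) : ℂ)) *
        (𝓕 u : L2 n) ξ) 2 volume := by
    intro j
    refine (Lp.memLp (𝓕 u : L2 n)).of_le ?_ (Filter.Eventually.of_forall fun ξ ↦ ?_)
    · refine (Continuous.aestronglyMeasurable ?_).mul (Lp.aestronglyMeasurable _)
      fun_prop
    · rw [norm_mul]
      exact mul_le_of_le_one_left (norm_nonneg _) (hb j ξ)
  refine ⟨fun j ↦ (hm j).toLp _, fun j ↦ (hm j).coeFn_toLp, ?_⟩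
  rw [tendsto_iff_norm_sub_tendsto_zero]
  have hsq : Filter.Tendsto (fun j ↦ ‖(hm j).toLp _ - (𝓕 u : L2 n)‖ ^ 2) Filter.atTop (nhds 0) := by
    have hae : ∀ j, (((hm j).toLp _ - (𝓕 u : L2 n) : L2 n) : Rn n → ℂ) =ᵐ[volume] fun ξ ↦
        (Complex.exp (-((1 / ((j : ℝ) + 1) * (2 * Real.pi * ‖ξ‖) ^ 2 : ℝ) : ℂ)) - 1) *
          (𝓕 u : L2 n) ξ := by
      intro j
      filter_upwards [Lp.coeFn_sub ((hm j).toLp _) (𝓕 u : L2 n), (hm j).coeFn_toLp] with ξ h1 h2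
      rw [h1, Pi.sub_apply, h2]
      ring
    simp_rw [norm_sq_eq_integral]
    have h0 : (0 : ℝ) = ∫ _ξ : Rn n, (0 : ℝ) := by simp
    rw [h0]
    refine tendsto_integral_of_dominated_convergence (fun ξ ↦ 4 * ‖(𝓕 u : L2 n) ξ‖ ^ 2)
      (fun j ↦ (integrable_norm_sq _).aestronglyMeasurable)
      ((integrable_norm_sq (𝓕 u)).const_mul 4) (fun j ↦ ?_) ?_
    · filter_upwards [hae j] with ξ hξ
      rw [hξ, norm_mul, mul_pow, norm_mul, norm_pow, norm_pow, norm_norm, norm_norm]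
      gcongr
      have := norm_sub_le (Complex.exp (-((1 / ((j : ℝ) + 1) * (2 * Real.pi * ‖ξ‖) ^ 2 : ℝ) : ℂ))) 1
      have h1 := hb j ξ
      rw [norm_one] at this
      nlinarith [norm_nonneg
        (Complex.exp (-((1 / ((j : ℝ) + 1) * (2 * Real.pi * ‖ξ‖) ^ 2 : ℝ) : ℂ)) - 1)]
    · filter_upwards [ae_all_iff.2 hae] with ξ hξ
      simp_rw [hξ]
      have hlim : Filter.Tendsto (fun j : ℕ ↦
          -((1 / ((j : ℝ) + 1) * (2 * Real.pi * ‖ξ‖) ^ 2 : ℝ) : ℂ)) Filter.atTop (nhds 0) := by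
        have h1 := (tendsto_one_div_add_atTop_nhds_zero_nat (𝕜 := ℝ)).mul_const
          ((2 * Real.pi * ‖ξ‖) ^ 2)
        have h2 := (Complex.continuous_ofReal.tendsto _).comp h1
        simpa using h2.neg
      have h3 := (((Complex.continuous_exp.tendsto 0).comp hlim).sub_const 1).mul_const
        ((𝓕 u : L2 n) ξ)
      have h4 := (h3.norm).pow 2
      simpa using h4
  have := hsq.sqrt
  simpa [Real.sqrt_sq] using this

/-- Interior real-analyticity for the fractional Laplacian, with bounds which are uniform in the
order and only depend on the distance to the boundary. -/
theorem exists_local_analytic (hn : 1 ≤ n) {δ : ℝ} (hδ : 0 < δ) :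
    ∃ C R r : ℝ, 0 < C ∧ 0 < R ∧ 0 < r ∧ ∀ s : ℝ, 0 < s → s < 1 → ∀ (u : L2 n) (x₀ : Rn n),
      (∀ φ : 𝓢(Rn n, ℂ), HasCompactSupport φ → tsupport φ ⊆ Metric.ball x₀ δ →
        fracLaplacePairing s u (φ.toLp 2 (volume : Measure (Rn n))) = 0) →
      ∃ (g : Rn n → ℂ) (p : FormalMultilinearSeries ℝ (Rn n) ℂ),
        HasFPowerSeriesOnBall g p x₀ (ENNReal.ofReal r) ∧ (∀ k, ‖p k‖ ≤ C * ‖u‖ * R ^ k) ∧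
        ∀ᵐ x, x ∈ Metric.ball x₀ r → u x = g x := by
  obtain ⟨C, hC, hmoll⟩ := exists_mollified_bound hn hδ
  set ρ : ℝ := min (δ / 8) 1 with hρ
  have hρ0 : 0 < ρ := by positivity
  set R : ℝ := 2 * Real.exp 1 / ρ with hR
  have hR0 : 0 < R := by positivity
  -- With this radius the Taylor series are dominated by a geometric series of ratio `1/2`.
  refine ⟨Real.exp 1 * C, R, 1 / (2 * R), by positivity, hR0, by positivity,
    fun s hs0 hs1 u x₀ hu ↦ ?_⟩
  obtain ⟨F, hFn, hF⟩ := exists_translated u x₀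
  have hharm := fracHarmonicNearZero_translated hF hu
  obtain ⟨H, hH, hHlim⟩ := exists_mollified_seq u
  have hlim : Filter.Tendsto (fun j ↦ (𝓕⁻ (H j) : L2 n)) Filter.atTop (nhds u) := by
    have := ((Lp.fourierTransformₗᵢ (Rn n) ℂ).symm.continuous.tendsto _).comp hHlim
    rwa [show (Lp.fourierTransformₗᵢ (Rn n) ℂ).symm (𝓕 u) = u from
      (Lp.fourierTransformₗᵢ (Rn n) ℂ).symm_apply_apply u] at this
  obtain ⟨ns, -, hae⟩ := exists_subseq_ae_tendsto hlim
  set ε : ℕ → ℝ := fun j ↦ 1 / ((j : ℝ) + 1) with hε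
  have hε0 : ∀ j, 0 < ε j := fun j ↦ by simp only [hε]; positivity
  have hε1 : ∀ j, ε j ≤ 1 := fun j ↦ by
    simp only [hε]
    rw [div_le_one (by positivity)]
    have : (0 : ℝ) ≤ j := Nat.cast_nonneg j
    linarith
  set G : ℕ → Rn n → ℂ := fun j ξ ↦
    F ξ * Complex.exp (-((ε j * (2 * Real.pi * ‖ξ‖) ^ 2 : ℝ) : ℂ)) with hG
  have hGm : ∀ j, AEStronglyMeasurable (G j) volume := fun j ↦ by
    refine (Lp.aestronglyMeasurable F).mul (Continuous.aestronglyMeasurable ?_)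
    fun_prop
  have hGi : ∀ j (M : ℝ), Integrable fun ξ ↦ ‖G j ξ‖ * Real.exp (M * (2 * Real.pi * ‖ξ‖)) := by
    intro j M
    obtain ⟨B, -, hB⟩ := exists_integral_norm_mul_exp_le (n := n) (hε0 j) M
    refine (hB F).1.congr (Filter.Eventually.of_forall fun ξ ↦ ?_)
    simp only [hG]
    rw [norm_mul, norm_cexp_neg_ofReal, mul_assoc ‖F ξ‖, ← Real.exp_add]
    congr 2
    ring
  -- The mollification as an everywhere defined function: the case `l = 1`, `h = x - x₀` of the
  -- complexified integral.
  set U : ℕ → Rn n → ℂ := fun j x ↦ ∫ ξ, G j ξ *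
    Complex.exp (2 * Real.pi * Complex.I * 1 * ((inner ℝ (x - x₀) ξ : ℝ) : ℂ)) with hUdef
  have hUeq : ∀ j, ((𝓕⁻ (H j) : L2 n) : Rn n → ℂ) =ᵐ[volume] U j := by
    intro j
    have hHi : Integrable (H j) := by
      refine (hGi j 0).mono' (Lp.aestronglyMeasurable _) ?_
      filter_upwards [hH j, hF] with ξ h1 h2
      simp only [hG]
      rw [h1, h2, zero_mul, Real.exp_zero, mul_one, norm_mul, norm_mul, norm_mul]
      have : ‖Complex.exp (2 * Real.pi * Complex.I * ((inner ℝ x₀ ξ : ℝ) : ℂ))‖ = 1 := by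
        rw [Complex.norm_exp]; simp
      rw [this, mul_one, mul_comm]
    filter_upwards [lp_fourierInv_ae_eq (H j) hHi] with x hx
    rw [hx, Real.fourierInv_eq']
    refine integral_congr_ae ?_
    filter_upwards [hH j, hF] with ξ h1 h2
    simp only [hG]
    rw [h1, h2, smul_eq_mul, inner_sub_left]
    have e : Complex.exp (((2 * Real.pi * inner ℝ ξ x : ℝ) : ℂ) * Complex.I) =
        Complex.exp (2 * Real.pi * Complex.I * ((inner ℝ x₀ ξ : ℝ) : ℂ)) *
          Complex.exp (2 * Real.pi * Complex.I * 1 *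
            ((inner ℝ x ξ - inner ℝ x₀ ξ : ℝ) : ℂ)) := by
      rw [← Complex.exp_add, real_inner_comm]
      congr 1
      push_cast
      ring
    rw [e]
    ring
  have hbound : ∀ j k, ‖taylorSeries (G j) k‖ ≤ Real.exp 1 * C * ‖u‖ * R ^ k := by
    intro j k
    have := norm_taylorSeries_le (hGm j) (hGi j) hρ0 (C := C * ‖F‖) (fun l hl h hh ↦ by
      have := hmoll s hs0 hs1 F hharm (ε j) (hε0 j) (hε1 j) l hl h (hh.trans (min_le_left _ _))
        (hh.trans (min_le_right _ _))
      simpa only [hG, mul_assoc] using this) k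
    rw [hFn, ← mul_assoc] at this
    exact this
  obtain ⟨g, p, hgp, hp, hlimg⟩ := exists_analytic_limit (U := fun i ↦ U (ns i))
    (q := fun i ↦ taylorSeries (G (ns i))) hR0 (by positivity : 0 < 1 / (2 * R))
    (by field_simp; norm_num) x₀ (fun i k ↦ hbound (ns i) k) (fun i h ↦ by
      have := hasSum_taylorSeries (hGm (ns i)) (hGi (ns i)) 1 h
      simpa [hUdef] using this)
  refine ⟨g, p, hgp, hp, ?_⟩
  filter_upwards [hae, ae_all_iff.2 hUeq] with x h1 h2 hx
  refine hlimg x hx _ (h1.congr fun i ↦ h2 (ns i))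

/-! ### Iterated partial derivatives -/

/-- On `Ω`, the function `h` is a derivative of `g` of order `k` in directions of length at
most one. -/
def IsUnitDirDeriv (Ω : Set (Rn n)) (g : Rn n → ℂ) (k : ℕ) (h : Rn n → ℂ) : Prop :=
  ∃ m : Fin k → Rn n, (∀ j, ‖m j‖ ≤ 1) ∧ ∀ x ∈ Ω, h x = iteratedFDeriv ℝ k g x m

lemma IsUnitDirDeriv.pderiv {Ω : Set (Rn n)} {g h : Rn n → ℂ} {k : ℕ} (hΩ : IsOpen Ω)
    (hg : AnalyticOnNhd ℝ g Ω) (hh : IsUnitDirDeriv Ω g k h) (i : Fin n) :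
    IsUnitDirDeriv Ω g (k + 1) (pderiv i h) := by
  obtain ⟨m, hm, hmh⟩ := hh
  refine ⟨Fin.cons (EuclideanSpace.single i 1) m, fun j ↦ ?_, fun x hx ↦ ?_⟩
  · refine Fin.cases ?_ (fun j ↦ ?_) j
    · simp
    · simpa using hm j
  · have hd : DifferentiableAt ℝ (iteratedFDeriv ℝ k g) x :=
      (hg.iteratedFDeriv k x hx).differentiableAt
    have he : h =ᶠ[nhds x] fun y ↦ iteratedFDeriv ℝ k g y m :=
      Filter.eventuallyEq_of_mem (hΩ.mem_nhds hx) hmh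
    rw [iteratedFDeriv_succ_apply_left, FracCalderon.pderiv, he.fderiv_eq,
      fderiv_continuousMultilinear_apply_const hd]
    simp

lemma IsUnitDirDeriv.iterate_pderiv {Ω : Set (Rn n)} {g h : Rn n → ℂ} {k : ℕ} (hΩ : IsOpen Ω)
    (hg : AnalyticOnNhd ℝ g Ω) (hh : IsUnitDirDeriv Ω g k h) (i : Fin n) (l : ℕ) :
    IsUnitDirDeriv Ω g (k + l) ((FracCalderon.pderiv i)^[l] h) := by
  induction l with
  | zero => exact hh
  | succ l ih =>
    rw [Function.iterate_succ_apply']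
    exact ih.pderiv hΩ hg i

lemma isUnitDirDeriv_mderiv {Ω : Set (Rn n)} {g : Rn n → ℂ} (hΩ : IsOpen Ω)
    (hg : AnalyticOnNhd ℝ g Ω) (τ : Fin n → ℕ) :
    IsUnitDirDeriv Ω g (mlen τ) (mderiv τ g) := by
  have key : ∀ l : List (Fin n), IsUnitDirDeriv Ω g (l.map τ).sum
      (l.foldr (fun i h ↦ (pderiv i)^[τ i] h) g) := by
    intro l
    induction l with
    | nil => exact ⟨fun _ ↦ 0, by simp, fun x _ ↦ (iteratedFDeriv_zero_apply _).symm⟩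
    | cons i l ih =>
      rw [List.map_cons, List.sum_cons, List.foldr_cons, add_comm]
      exact ih.iterate_pderiv hΩ hg i (τ i)
  have hsum : ((List.finRange n).map τ).sum = mlen τ := by
    rw [mlen, ← List.ofFn_eq_map, List.sum_ofFn]
  rw [← hsum]
  exact key _

lemma norm_mderiv_le {Ω : Set (Rn n)} {g : Rn n → ℂ} (hΩ : IsOpen Ω)
    (hg : AnalyticOnNhd ℝ g Ω) (τ : Fin n → ℕ) {x : Rn n} (hx : x ∈ Ω) :
    ‖mderiv τ g x‖ ≤ ‖iteratedFDeriv ℝ (mlen τ) g x‖ := by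
  obtain ⟨m, hm, hmg⟩ := isUnitDirDeriv_mderiv hΩ hg τ
  rw [hmg x hx]
  refine (ContinuousMultilinearMap.le_opNorm _ _).trans ?_
  exact mul_le_of_le_one_right (norm_nonneg _)
    (Finset.prod_le_one (fun _ _ ↦ norm_nonneg _) fun j _ ↦ hm j)

/-- The derivative is the sum of `p k` over all permutations of its arguments, and `k! ≤ k^k`. -/
lemma norm_iteratedFDeriv_le {g : Rn n → ℂ} {p : FormalMultilinearSeries ℝ (Rn n) ℂ} {x : Rn n}
    (hg : HasFPowerSeriesAt g p x) (k : ℕ) :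
    ‖iteratedFDeriv ℝ k g x‖ ≤ (k : ℝ) ^ k * ‖p k‖ := by
  obtain ⟨r, hr⟩ := hg
  refine ContinuousMultilinearMap.opNorm_le_bound (by positivity) fun v ↦ ?_
  rw [hr.iteratedFDeriv_eq_sum_of_completeSpace]
  have hfac : ((k.factorial : ℕ) : ℝ) ≤ (k : ℝ) ^ k := by exact_mod_cast k.factorial_le_pow
  calc ‖∑ σ : Equiv.Perm (Fin k), p k fun i ↦ v (σ i)‖
      ≤ ∑ σ : Equiv.Perm (Fin k), ‖p k‖ * ∏ i, ‖v i‖ := by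
        refine norm_sum_le_of_le _ fun σ _ ↦ ((p k).le_opNorm _).trans_eq ?_
        rw [Equiv.prod_comp σ fun i ↦ ‖v i‖]
    _ = k.factorial * (‖p k‖ * ∏ i, ‖v i‖) := by
        rw [Finset.sum_const, Finset.card_univ, Fintype.card_perm, Fintype.card_fin, nsmul_eq_mul]
    _ ≤ (k : ℝ) ^ k * (‖p k‖ * ∏ i, ‖v i‖) := by gcongr
    _ = _ := by ring

/-! ### Test functions and gluing -/

open scoped Laplacian in
lemma memHs_schwartz {s : ℝ} (hs1 : s ≤ 1) (φ : 𝓢(Rn n, ℂ)) :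
    MemHs s (φ.toLp 2 (volume : Measure (Rn n))) := by
  have h : MemLp (𝓕 (φ - Δ φ) : 𝓢(Rn n, ℂ)) 2 (volume : Measure (Rn n)) :=
    SchwartzMap.memLp _ 2 volume
  refine lt_of_le_of_lt (eLpNorm_mono_ae ?_) h.2
  have hae : ((𝓕 (φ.toLp 2 (volume : Measure (Rn n))) : L2 n) : Rn n → ℂ) =ᵐ[volume]
      (𝓕 φ : 𝓢(Rn n, ℂ)) := by
    rw [SchwartzMap.toLp_fourier_eq]
    exact SchwartzMap.coeFn_toLp _ _ _
  filter_upwards [hae] with ξ hξ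
  rw [hξ, fourier_sub_laplacian, norm_mul, norm_mul, Complex.norm_real, Complex.norm_real]
  gcongr
  have h1 : (1 : ℝ) ≤ 1 + (2 * Real.pi * ‖ξ‖) ^ 2 := by nlinarith [sq_nonneg (2 * Real.pi * ‖ξ‖)]
  rw [Real.norm_of_nonneg (by positivity), Real.norm_of_nonneg (by positivity)]
  simpa using Real.rpow_le_rpow_of_exponent_le h1 (by linarith : s / 2 ≤ 1)

lemma IsWeakSolution.pairing_schwartz_eq_zero {s : ℝ} (hs1 : s ≤ 1) {Ω : Set (Rn n)} {f u : L2 n}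
    (hu : IsWeakSolution s Ω f u) {φ : 𝓢(Rn n, ℂ)} (hφ : tsupport φ ⊆ Ω) :
    fracLaplacePairing s u (φ.toLp 2 volume) = 0 := by
  refine hu.equation _ (memHs_schwartz hs1 φ) ?_
  have hm : MeasurableSet (exteriorSet Ω) := isClosed_closure.measurableSet.compl
  rw [ae_restrict_iff' hm]
  filter_upwards [SchwartzMap.coeFn_toLp φ 2 (volume : Measure (Rn n))] with x hx hxe
  rw [hx]
  exact image_eq_zero_of_notMem_tsupport fun h ↦ hxe (subset_closure (hφ h))

/-- Functions that are locally almost everywhere equal to analytic functions are almost everywhere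
equal to an analytic function. -/
lemma exists_glued_analytic {Ω : Set (Rn n)} (u : Rn n → ℂ)
    {G : Rn n → Rn n → ℂ} {P : Rn n → FormalMultilinearSeries ℝ (Rn n) ℂ} {r : Rn n → ℝ}
    (hr : ∀ x ∈ Ω, 0 < r x)
    (hG : ∀ x ∈ Ω, HasFPowerSeriesOnBall (G x) (P x) x (ENNReal.ofReal (r x)))
    (hu : ∀ x ∈ Ω, ∀ᵐ y, y ∈ Metric.ball x (r x) → u y = G x y) (hΩ : IsOpen Ω) :
    ∃ g : Rn n → ℂ, (∀ᵐ x ∂(volume.restrict Ω), u x = g x) ∧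
      ∀ x ∈ Ω, HasFPowerSeriesAt g (P x) x := by
  have hcont : ∀ x ∈ Ω, ContinuousOn (G x) (Metric.ball x (r x)) := fun x hx ↦ by
    have := (hG x hx).continuousOn
    rwa [Metric.eball_ofReal] at this
  have heq : ∀ x ∈ Ω, ∀ y ∈ Ω, y ∈ Metric.ball x (r x) → G x y = G y y := by
    -- On the intersection of the two balls both functions are continuous and almost everywhere
    -- equal to `u`, hence equal.
    intro x hx y hy hyx
    refine Measure.eqOn_open_of_ae_eq (μ := volume)
      (U := Metric.ball x (r x) ∩ Metric.ball y (r y)) (f := G x) (g := G y) ?_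
      (Metric.isOpen_ball.inter Metric.isOpen_ball) ((hcont x hx).mono inter_subset_left)
      ((hcont y hy).mono inter_subset_right) ⟨hyx, Metric.mem_ball_self (hr y hy)⟩
    refine (ae_restrict_iff' (Metric.isOpen_ball.inter Metric.isOpen_ball).measurableSet).2 ?_
    filter_upwards [hu x hx, hu y hy] with z h1 h2 hz
    rw [← h1 hz.1, ← h2 hz.2]
  refine ⟨fun x ↦ G x x, ?_, fun x hx ↦ ?_⟩
  · rw [ae_restrict_iff' hΩ.measurableSet, ae_iff]
    refine measure_null_of_locally_null _ fun x hx ↦ ?_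
    have hxΩ : x ∈ Ω := by
      by_contra h
      exact hx fun h' ↦ absurd h' h
    refine ⟨_, inter_mem_nhdsWithin _ (Metric.ball_mem_nhds x (hr x hxΩ)), ?_⟩
    refine measure_mono_null ?_ (ae_iff.1 (hu x hxΩ))
    rintro y ⟨hy1, hy2⟩ hy3
    refine hy1 fun hyΩ ↦ ?_
    rw [hy3 hy2, heq x hxΩ y hyΩ hy2]
  · refine (hG x hx).hasFPowerSeriesAt.congr ?_
    filter_upwards [hΩ.mem_nhds hx, Metric.ball_mem_nhds x (hr x hx)] with y hy1 hy2
    exact heq x hx y hy1 hy2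

/-- Weak solutions are analytic in `Ω`, with uniform bounds on compact subsets. -/
lemma exists_analytic_representative (hn : 1 ≤ n) {Ω K : Set (Rn n)} (hΩ : IsOpen Ω)
    (hK : IsCompact K) (hKΩ : K ⊆ Ω) :
    ∃ C R : ℝ, 0 < C ∧ 0 < R ∧ ∀ s : ℝ, 0 < s → s < 1 → ∀ f u : L2 n, IsWeakSolution s Ω f u →
      ∃ g : Rn n → ℂ, (∀ᵐ x ∂(volume.restrict Ω), u x = g x) ∧ AnalyticOnNhd ℝ g Ω ∧
        ∀ τ : Fin n → ℕ, ∀ x ∈ K,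
          ‖mderiv τ g x‖ ≤ C * ‖u‖ * R ^ mlen τ * (mlen τ : ℝ) ^ mlen τ := by
  -- One `δ` serves all points of `K`, which makes the constants uniform there; at other points of
  -- `Ω` only qualitative analyticity is needed and the radius may depend on the point.
  obtain ⟨δ, hδ, hδΩ⟩ := hK.exists_thickening_subset_open hΩ hKΩ
  obtain ⟨C, R, r, hC, hR, hr, hloc⟩ := exists_local_analytic (n := n) hn hδ
  refine ⟨C, R, hC, hR, fun s hs0 hs1 f u hu ↦ ?_⟩
  have hex : ∀ x : Rn n, ∃ (G : Rn n → ℂ) (p : FormalMultilinearSeries ℝ (Rn n) ℂ) (ρ : ℝ),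
      x ∈ Ω → 0 < ρ ∧ HasFPowerSeriesOnBall G p x (ENNReal.ofReal ρ) ∧
        (∀ᵐ y, y ∈ Metric.ball x ρ → u y = G y) ∧
        (x ∈ K → ∀ k, ‖p k‖ ≤ C * ‖u‖ * R ^ k) := by
    intro x
    by_cases hxK : x ∈ K
    · obtain ⟨G, p, hG, hp, hae⟩ := hloc s hs0 hs1 u x fun φ _ hφ ↦
        hu.pairing_schwartz_eq_zero hs1.le
          (hφ.trans ((Metric.ball_subset_thickening hxK δ).trans hδΩ))
      exact ⟨G, p, r, fun _ ↦ ⟨hr, hG, hae, fun _ ↦ hp⟩⟩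
    · by_cases hx : x ∈ Ω
      · obtain ⟨ε, hε, hεΩ⟩ := Metric.isOpen_iff.1 hΩ x hx
        obtain ⟨C', R', ρ, -, -, hρ, hloc'⟩ := exists_local_analytic (n := n) hn hε
        obtain ⟨G, p, hG, -, hae⟩ := hloc' s hs0 hs1 u x fun φ _ hφ ↦
          hu.pairing_schwartz_eq_zero hs1.le (hφ.trans hεΩ)
        exact ⟨G, p, ρ, fun _ ↦ ⟨hρ, hG, hae, fun h ↦ absurd h hxK⟩⟩
      · exact ⟨0, 0, 0, fun h ↦ absurd h hx⟩
  choose G P ρ hGP using hex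
  obtain ⟨g, hug, hg⟩ := exists_glued_analytic (u : Rn n → ℂ) (fun x hx ↦ (hGP x hx).1)
    (fun x hx ↦ (hGP x hx).2.1) (fun x hx ↦ (hGP x hx).2.2.1) hΩ
  have hga : AnalyticOnNhd ℝ g Ω := fun x hx ↦ (hg x hx).analyticAt
  refine ⟨g, hug, hga, fun τ x hx ↦ ?_⟩
  have hxΩ := hKΩ hx
  calc ‖mderiv τ g x‖ ≤ ‖iteratedFDeriv ℝ (mlen τ) g x‖ := norm_mderiv_le hΩ hga τ hxΩ
    _ ≤ (mlen τ : ℝ) ^ mlen τ * ‖P x (mlen τ)‖ := norm_iteratedFDeriv_le (hg x hxΩ) _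
    _ ≤ (mlen τ : ℝ) ^ mlen τ * (C * ‖u‖ * R ^ mlen τ) := by
      gcongr
      exact (hGP x hxΩ).2.2.2 hx _
    _ = _ := by ring

end FracCalderon

end

/-! ### Well-posedness combined with interior analyticity -/

theorem proposition3p4 {n : ℕ} (hn : 2 ≤ n)
    (Ω Ω' W : Set (FracCalderon.Rn n))
    (hΩ : IsOpen Ω) (hΩne : Ω.Nonempty) (hΩb : Bornology.IsBounded Ω)
    (hΩ' : IsCompact Ω') (hΩ'ne : Ω'.Nonempty) (hΩ'Ω : Ω' ⊆ Ω)
    (hW : IsOpen W) (hWne : W.Nonempty) (hWΩ : W ⊆ FracCalderon.exteriorSet Ω) :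
    ∃ C R : ℝ, 0 < C ∧ 0 < R ∧
      ∀ s : ℝ, 0 < s → s < 1 →
      ∀ f : FracCalderon.L2 n, FracCalderon.MemHsTilde s W f →
        (∃! u : FracCalderon.L2 n, FracCalderon.IsWeakSolution s Ω f u) ∧
        ∀ u₀ : FracCalderon.L2 n, FracCalderon.IsWeakSolution s Ω f u₀ →
          ∃ g : FracCalderon.Rn n → ℂ,
            (∀ᵐ x ∂(MeasureTheory.volume.restrict Ω), u₀ x = g x) ∧
            AnalyticOnNhd ℝ g Ω ∧
            FracCalderon.MemGevrey 1 Ω' g ∧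
            ∀ τ : Fin n → ℕ, ∀ x ∈ Ω',
              ‖FracCalderon.mderiv τ g x‖ ≤
                C * (FracCalderon.hsNorm s f).toReal * R ^ FracCalderon.mlen τ *
                  (FracCalderon.mlen τ : ℝ) ^ FracCalderon.mlen τ := by
  obtain ⟨A, hA, hwell⟩ := FracCalderon.exists_wellposed (n := n) (Ω := Ω) (by omega) hΩb
  obtain ⟨B, R, hB, hR, hana⟩ := FracCalderon.exists_analytic_representative (n := n) (by omega)
    hΩ hΩ' hΩ'Ω
  refine ⟨B * A, R, mul_pos hB hA, hR, fun s hs0 hs1 f hf ↦ ?_⟩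
  obtain ⟨hex, hbound⟩ := hwell s hs0 hs1 f hf.1
  refine ⟨hex, fun u hu ↦ ?_⟩
  obtain ⟨g, hug, hg, hτ⟩ := hana s hs0 hs1 f u hu
  -- The summand `1` keeps the Gevrey constant positive when `u = 0`.
  refine ⟨g, hug, hg, ⟨⟨Ω, hΩ, hΩ'Ω, hg.contDiffOn hΩ.uniqueDiffOn⟩, B * ‖u‖ + 1, R,
    by positivity, hR, fun τ x hx ↦ (hτ τ x hx).trans ?_⟩, fun τ x hx ↦ (hτ τ x hx).trans ?_⟩
  · rw [one_mul, Real.rpow_natCast]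
    gcongr
    linarith
  · rw [mul_assoc B A]
    gcongr
    exact hbound u hu
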